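/- **Languages.** Let $\mathsf{PROP},\mathsf{FVAR},\mathsf{NOM},\mathsf{CNOM}$ be disjoint countably infinite sets of propositional variables $p$, fixed point variables $X$, nominals $\mathbf i,\mathbf j$ and co-nominals $\mathbf m,\mathbf n$. The formulas of $\mathcal L_1$ are built from $\bot,\top,p,X$ by $\wedge,\vee,\to,-,\Diamond,\Box$ and by the binders $\mu X.\varphi$, $\nu X.\varphi$, allowed when every free occurrence of $X$ in $\varphi$ is positive; signs are inherited by subformulas, except that they are reversed in the left argument of $\to$ and the right argument of $-$. The formulas of $\mathcal L^+_*$ are built likewise with, in addition, nominals, co-nominals and the unary connectives $\blacklozenge,\blacksquare$, and with binders $\mu^*,\nu^*$ in place of $\mu,\nu$. For $\varphi\in\mathcal L_1$, $\varphi^*$ is obtained by replacing $\mu,\nu$ by $\mu^*,\nu^*$. An $\mathcal L_1$-inequality is an expression $\varphi\le\psi$ in which $\varphi,\psi\in\mathcal L_1$ have no free fixed point variables. A formula is positive (negative) in $p$ if all occurrences of $p$ in it are positive (negative). **Algebras.** A modal bi-Heyting algebra $\mathbf A$ is a bounded lattice $A$ with operations $\to,-$ satisfying $a\wedge b\le c\Leftrightarrow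 a\le b\to c$ and $a-b\le c\Leftrightarrow a\le b\vee c$, and with $\Box$ preserving finite meets and $\Diamond$ preserving finite joins (including the empty ones). In $\mathbf A$, $\mu X.\varphi$ is interpreted as $\bigwedge\{a\in A\mid \varphi(a)\le a\}$ and $\nu X.\varphi$ as $\bigvee\{a\in A\mid a\le\varphi(a)\}$, if these exist; $\mathbf A$ is a mu-algebra of the first kind if every $\mathcal L_1$-formula is defined under every assignment of its variables in $A$. $\mathbf A\models\varphi\le\psi$ means that the inequality holds under all assignments. The canonical extension $\mathbf A^\delta$ is the (up to isomorphism over $A$ unique) completely distributive complete lattice containing $A$ as a bounded sublattice such that every element is a join of closed elements (meets of subsets of $A$) and a meet of open elements (joins of subsets of $A$), and such that for $S,T\subseteq A$, $\bigwedge S\le\bigvee T$ implies $\bigwedge S'\le\bigvee T'$ for some finite $S'\subseteq S$, $T'\subseteq T$. On $\mathbf A^\delta$, $\to$ and $-$ are the residuals of $\wedge$ and $\vee$; with $k$ ranging over closed and $u$ over open elements, $$\Diamond c=\bigvee_{k\le c\le u}\bigwedge\{\Diamond a\mid a\in A,\,k\le a\le u\},\qquad \Box c=\bigwedge_{k\le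 c\le u}\bigvee\{\Box a\mid a\in A,\,k\le a\le u\};$$ $\blacksquare$ is the right adjoint of $\Diamond$ and $\blacklozenge$ the left adjoint of $\Box$. In $\mathbf A^\delta$, $\mu^*X.\varphi:=\bigwedge\{a\in A\mid\varphi(a)\le a\}$ and $\nu^*X.\varphi:=\bigvee\{a\in A\mid a\le\varphi(a)\}$. Assignments on $\mathbf A^\delta$ send propositional variables to arbitrary elements, nominals to completely join-irreducible and co-nominals to completely meet-irreducible elements. An $\mathcal L_1$-inequality $\varphi\le\psi$ is *tame canonical* if for every mu-algebra $\mathbf A$ of the first kind: $\mathbf A\models\varphi\le\psi$ if and only if $\mathbf A^\delta\models\varphi^*\le\psi^*$. **Tame runs of $\mu^*$-ALBA.** A tame run on $\varphi\le\psi$ proceeds as follows. 1. *Preprocessing.* Starting from the set consisting of $\varphi\le\psi$ alone, apply finitely often to one of the current inequalities: in $+(\text{left side})$ and $-(\text{right side})$, distribute a positive $\Diamond$ or $\wedge$ over a positive $\vee$, or a negative $\Box$ or $\vee$ over a negative $\wedge$; replace $\alpha\vee\beta\le\gamma$ by $\alpha\le\gamma$ and $\beta\le\gamma$; replace $\alpha\le\beta\wedge\gamma$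 by $\alpha\le\beta$ and $\alpha\le\gamma$; replace $\alpha(p)\le\beta(p)$ by $\alpha(\bot)\le\beta(\bot)$ if $\alpha$ is negative and $\beta$ positive in $p$, and by $\alpha(\top)\le\beta(\top)$ if $\alpha$ is positive and $\beta$ negative in $p$. 2. *Starring and first approximation.* Each resulting inequality $\eta\le\beta$ is replaced by the quasi-inequality $\mathbf j\le\eta^*\ \&\ \beta^*\le\mathbf m\Rightarrow\mathbf j\le\mathbf m$, which is treated separately from then on. 3. *Rules*, applied finitely often to inequalities of the antecedent. - Residuation: $\chi-\psi\le\varphi$ becomes $\chi\le\psi\vee\varphi$; $\varphi\le\chi\to\psi$ becomes $\varphi\wedge\chi\le\psi$; $\chi\wedge\psi\le\varphi$ becomes $\chi\le\psi\to\varphi$ or $\psi\le\chi\to\varphi$; $\varphi\le\chi\vee\psi$ becomes $\varphi-\chi\le\psi$ or $\varphi-\psi\le\chi$. - Adjunction: $\varphi\vee\chi\le\psi$ becomes $\varphi\le\psi\ \&\ \chi\le\psi$; $\psi\le\varphi\wedge\chi$ becomes $\psi\le\varphi\ \&\ \psi\le\chi$; $\Diamond\varphi\le\psi$ becomes $\varphi\le\blacksquare\psi$;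 $\varphi\le\Box\psi$ becomes $\blacklozenge\varphi\le\psi$. - Approximation, where the new (co-)nominals do not occur in the quasi-inequality: $\Box\psi\le\mathbf m$ becomes $\Box\mathbf n\le\mathbf m\ \&\ \psi\le\mathbf n$; $\mathbf j\le\Diamond\psi$ becomes $\mathbf j\le\Diamond\mathbf i\ \&\ \mathbf i\le\psi$; $\chi\to\varphi\le\mathbf m$ becomes $\mathbf j\to\mathbf n\le\mathbf m\ \&\ \mathbf j\le\chi\ \&\ \varphi\le\mathbf n$; $\mathbf i\le\chi-\varphi$ becomes $\mathbf i\le\mathbf j-\mathbf n\ \&\ \mathbf j\le\chi\ \&\ \varphi\le\mathbf n$. - Right Ackermann rule: $\&_{i=1}^n\alpha_i\le p\ \&\ \&_{j}\beta_j(p)\le\gamma_j(p)$ becomes $\&_j\,\beta_j(\bigvee_i\alpha_i)\le\gamma_j(\bigvee_i\alpha_i)$, if the $\alpha_i$ are $p$-free and syntactically closed, the $\beta_j$ positive in $p$ and syntactically closed, the $\gamma_j$ negative in $p$ and syntactically open, and all other inequalities of the quasi-inequality are $p$-free. - Left Ackermann rule: $\&_{i=1}^n p\le\alpha_i\ \&\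 \&_{j}\gamma_j(p)\le\beta_j(p)$ becomes $\&_j\,\gamma_j(\bigwedge_i\alpha_i)\le\beta_j(\bigwedge_i\alpha_i)$, if the $\alpha_i$ are $p$-free and syntactically open, the $\beta_j$ positive in $p$ and syntactically open, the $\gamma_j$ negative in $p$ and syntactically closed, and all other inequalities of the quasi-inequality are $p$-free. Here a formula of $\mathcal L^+_*$ is *syntactically open* if all occurrences of nominals, $\blacklozenge$ and $\mu^*$ in it are negative and all occurrences of co-nominals, $\blacksquare$ and $\nu^*$ are positive; it is *syntactically closed* if all occurrences of nominals, $\blacklozenge$ and $\mu^*$ are positive and all occurrences of co-nominals, $\blacksquare$ and $\nu^*$ are negative. (The full algorithm $\mu^*$-ALBA has two further rules, the approximation rules for fixed point binders; a run is tame if it never uses them.) The run *succeeds* if none of the final quasi-inequalities contains a propositional variable. **Theorem (Tame Canonicity).** Every $\mathcal L_1$-inequality on which some tame run of $\mu^*$-ALBA succeeds is tame canonical. -/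

import Mathlib

universe u v

namespace MuALBA

/-! ## Modal bi-Heyting algebras -/

/-- A bi-Heyting algebra with an operation `box` that preserves finite meets and an operation
`dia` that preserves finite joins. The implication is `a ⇨ b`, the subtraction is `a \ b`. -/
class ModalBiHeyting (A : Type u) extends BiheytingAlgebra A where
  box : A → A
  dia : A → A
  box_top : box ⊤ = ⊤
  box_inf : ∀ a b, box (a ⊓ b) = box a ⊓ box b
  dia_bot : dia ⊥ = ⊥
  dia_sup : ∀ a b, dia (a ⊔ b) = dia a ⊔ dia b

/-! ## Formulas -/

/-- Formulas with propositional variables, fixed point variables, nominals and co-nominals (all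
indexed by `ℕ`). `sub` is the subtraction, `bbox` and `bdia` are the adjoint (black) modalities,
`mu`, `nu` are the plain binders and `muS`, `nuS` the starred binders. -/
inductive Form : Type
  | bot : Form
  | top : Form
  | prop (p : ℕ) : Form
  | fvar (X : ℕ) : Form
  | nom (j : ℕ) : Form
  | cnom (m : ℕ) : Form
  | and (φ ψ : Form) : Form
  | or (φ ψ : Form) : Form
  | imp (φ ψ : Form) : Form
  | sub (φ ψ : Form) : Form
  | dia (φ : Form) : Form
  | box (φ : Form) : Form
  | bbox (φ : Form) : Form
  | bdia (φ : Form) : Form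
  | mu (X : ℕ) (φ : Form) : Form
  | nu (X : ℕ) (φ : Form) : Form
  | muS (X : ℕ) (φ : Form) : Form
  | nuS (X : ℕ) (φ : Form) : Form

namespace Form

/-- The propositional variables that occur in a formula. -/
def props : Form → Finset ℕ
  | bot | top | fvar _ | nom _ | cnom _ => ∅
  | prop p => {p}
  | and φ ψ | or φ ψ | imp φ ψ | sub φ ψ => φ.props ∪ ψ.props
  | dia φ | box φ | bbox φ | bdia φ => φ.props
  | mu _ φ | nu _ φ | muS _ φ | nuS _ φ => φ.props

/-- The nominals that occur in a formula. -/
def noms : Form → Finset ℕ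
  | bot | top | fvar _ | prop _ | cnom _ => ∅
  | nom j => {j}
  | and φ ψ | or φ ψ | imp φ ψ | sub φ ψ => φ.noms ∪ ψ.noms
  | dia φ | box φ | bbox φ | bdia φ => φ.noms
  | mu _ φ | nu _ φ | muS _ φ | nuS _ φ => φ.noms

/-- The co-nominals that occur in a formula. -/
def cnoms : Form → Finset ℕ
  | bot | top | fvar _ | prop _ | nom _ => ∅
  | cnom m => {m}
  | and φ ψ | or φ ψ | imp φ ψ | sub φ ψ => φ.cnoms ∪ ψ.cnoms
  | dia φ | box φ | bbox φ | bdia φ => φ.cnoms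
  | mu _ φ | nu _ φ | muS _ φ | nuS _ φ => φ.cnoms

/-- The fixed point variables that occur free in a formula. -/
def freeVars : Form → Finset ℕ
  | bot | top | prop _ | nom _ | cnom _ => ∅
  | fvar X => {X}
  | and φ ψ | or φ ψ | imp φ ψ | sub φ ψ => φ.freeVars ∪ ψ.freeVars
  | dia φ | box φ | bbox φ | bdia φ => φ.freeVars
  | mu X φ | nu X φ | muS X φ | nuS X φ => φ.freeVars.erase X

/-- A sentence has no free fixed point variables. -/
def IsSentence (φ : Form) : Prop := φ.freeVars = ∅

/-- `PropSign p s φ`: in the generation tree of `φ` whose root has sign `s` (`true` is `+`,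
`false` is `-`), every node labelled by the propositional variable `p` has sign `+`. -/
def PropSign (p : ℕ) : Bool → Form → Prop
  | _, bot | _, top | _, fvar _ | _, nom _ | _, cnom _ => True
  | s, prop q => q = p → s = true
  | s, and φ ψ | s, or φ ψ => PropSign p s φ ∧ PropSign p s ψ
  | s, imp φ ψ => PropSign p (!s) φ ∧ PropSign p s ψ
  | s, sub φ ψ => PropSign p s φ ∧ PropSign p (!s) ψ
  | s, dia φ | s, box φ | s, bbox φ | s, bdia φ => PropSign p s φ
  | s, mu _ φ | s, nu _ φ | s, muS _ φ | s, nuS _ φ => PropSign p s φ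

/-- `φ` is positive in `p`: all `p`-nodes of the tree `+φ` are signed `+`. -/
def PosIn (p : ℕ) (φ : Form) : Prop := PropSign p true φ

/-- `φ` is negative in `p`: all `p`-nodes of the tree `+φ` are signed `-`, that is, all `p`-nodes
of the tree `-φ` are signed `+`. -/
def NegIn (p : ℕ) (φ : Form) : Prop := PropSign p false φ

/-- `VarSign X s φ`: in the generation tree of `φ` whose root has sign `s`, every free occurrence
of the fixed point variable `X` has sign `+`. -/
def VarSign (X : ℕ) : Bool → Form → Prop
  | _, bot | _, top | _, prop _ | _, nom _ | _, cnom _ => True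
  | s, fvar Y => Y = X → s = true
  | s, and φ ψ | s, or φ ψ => VarSign X s φ ∧ VarSign X s ψ
  | s, imp φ ψ => VarSign X (!s) φ ∧ VarSign X s ψ
  | s, sub φ ψ => VarSign X s φ ∧ VarSign X (!s) ψ
  | s, dia φ | s, box φ | s, bbox φ | s, bdia φ => VarSign X s φ
  | s, mu Y φ | s, nu Y φ | s, muS Y φ | s, nuS Y φ => Y = X ∨ VarSign X s φ

/-- The formulas of the language with the plain binders `μ` and `ν` (no nominals, co-nominals,
black modalities or starred binders), where the body of a binder is positive in the bound
variable. -/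
def IsL1 : Form → Prop
  | bot | top | prop _ | fvar _ => True
  | and φ ψ | or φ ψ | imp φ ψ | sub φ ψ => IsL1 φ ∧ IsL1 ψ
  | dia φ | box φ => IsL1 φ
  | mu X φ | nu X φ => IsL1 φ ∧ VarSign X true φ
  | nom _ | cnom _ | bbox _ | bdia _ | muS _ _ | nuS _ _ => False

/-- `φ.star` replaces all occurrences of `μ` and `ν` by `μ*` and `ν*`. -/
def star : Form → Form
  | bot => bot
  | top => top
  | prop p => prop p
  | fvar X => fvar X
  | nom j => nom j
  | cnom m => cnom m
  | and φ ψ => and φ.star ψ.star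
  | or φ ψ => or φ.star ψ.star
  | imp φ ψ => imp φ.star ψ.star
  | sub φ ψ => sub φ.star ψ.star
  | dia φ => dia φ.star
  | box φ => box φ.star
  | bbox φ => bbox φ.star
  | bdia φ => bdia φ.star
  | mu X φ => muS X φ.star
  | nu X φ => nuS X φ.star
  | muS X φ => muS X φ.star
  | nuS X φ => nuS X φ.star

/-- Substitution of `α` for the propositional variable `p`. It is only ever used with a sentence
`α`, so that no variable can be captured. -/
def subst (p : ℕ) (α : Form) : Form → Form
  | bot => bot
  | top => top
  | prop q => if q = p then α else prop q
  | fvar X => fvar X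
  | nom j => nom j
  | cnom m => cnom m
  | and φ ψ => and (subst p α φ) (subst p α ψ)
  | or φ ψ => or (subst p α φ) (subst p α ψ)
  | imp φ ψ => imp (subst p α φ) (subst p α ψ)
  | sub φ ψ => sub (subst p α φ) (subst p α ψ)
  | dia φ => dia (subst p α φ)
  | box φ => box (subst p α φ)
  | bbox φ => bbox (subst p α φ)
  | bdia φ => bdia (subst p α φ)
  | mu X φ => mu X (subst p α φ)
  | nu X φ => nu X (subst p α φ)
  | muS X φ => muS X (subst p α φ)
  | nuS X φ => nuS X (subst p α φ)

/-- The disjunction of a finite list (`⊥` for the empty list). -/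
def bigOr : List Form → Form
  | [] => bot
  | [φ] => φ
  | φ :: ψ :: l => or φ (bigOr (ψ :: l))

/-- The conjunction of a finite list (`⊤` for the empty list). -/
def bigAnd : List Form → Form
  | [] => top
  | [φ] => φ
  | φ :: ψ :: l => and φ (bigAnd (ψ :: l))

/-- `SynOC true` are the syntactically open formulas and `SynOC false` the syntactically closed
formulas, by simultaneous recursion. Fixed point variables are treated like propositional
variables: they range over the elements of the original algebra. -/
def SynOC : Bool → Form → Prop
  | _, bot | _, top | _, prop _ | _, fvar _ => True
  | b, cnom _ => b = true
  | b, nom _ => b = false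
  | b, and φ ψ | b, or φ ψ => SynOC b φ ∧ SynOC b ψ
  | b, imp φ ψ => SynOC (!b) φ ∧ SynOC b ψ
  | b, sub φ ψ => SynOC b φ ∧ SynOC (!b) ψ
  | b, dia φ | b, box φ => SynOC b φ
  | b, bbox φ => b = true ∧ SynOC b φ
  | b, bdia φ => b = false ∧ SynOC b φ
  | b, nuS _ φ => b = true ∧ SynOC b φ
  | b, muS _ φ => b = false ∧ SynOC b φ
  | _, mu _ _ | _, nu _ _ => False

/-- Syntactically open formulas. -/
def SynOpen (φ : Form) : Prop := SynOC true φ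

/-- Syntactically closed formulas. -/
def SynClosed (φ : Form) : Prop := SynOC false φ

end Form

/-! ## Interpretation in a modal bi-Heyting algebra -/

section Algebra

variable {A : Type u} [ModalBiHeyting A]

/-- `Denotes v φ ρ a`: under the assignment `v` of the propositional variables and `ρ` of the free
fixed point variables, the formula `φ` is defined in `A` and its value is `a`. A least fixed point
is the meet in `A` of the set of pre-fixed points, if this meet exists, and a greatest fixed point
the join of the set of post-fixed points, if this join exists. Formulas outside the language with
the plain binders have no value. -/
def Denotes (v : ℕ → A) : Form → (ℕ → A) → A → Prop
  | .bot, _, a => a = ⊥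
  | .top, _, a => a = ⊤
  | .prop p, _, a => a = v p
  | .fvar X, ρ, a => a = ρ X
  | .and φ ψ, ρ, a => ∃ b c, Denotes v φ ρ b ∧ Denotes v ψ ρ c ∧ a = b ⊓ c
  | .or φ ψ, ρ, a => ∃ b c, Denotes v φ ρ b ∧ Denotes v ψ ρ c ∧ a = b ⊔ c
  | .imp φ ψ, ρ, a => ∃ b c, Denotes v φ ρ b ∧ Denotes v ψ ρ c ∧ a = b ⇨ c
  | .sub φ ψ, ρ, a => ∃ b c, Denotes v φ ρ b ∧ Denotes v ψ ρ c ∧ a = b \ c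
  | .dia φ, ρ, a => ∃ b, Denotes v φ ρ b ∧ a = ModalBiHeyting.dia b
  | .box φ, ρ, a => ∃ b, Denotes v φ ρ b ∧ a = ModalBiHeyting.box b
  | .mu X φ, ρ, a => IsGLB {b | ∃ c, Denotes v φ (Function.update ρ X b) c ∧ c ≤ b} a
  | .nu X φ, ρ, a => IsLUB {b | ∃ c, Denotes v φ (Function.update ρ X b) c ∧ b ≤ c} a
  | .nom _, _, _ | .cnom _, _, _ | .bbox _, _, _ | .bdia _, _, _ => False
  | .muS _ _, _, _ | .nuS _ _, _, _ => False

variable (A) in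
/-- `A` is a mu-algebra of the first kind: every formula with the plain binders is defined under
every assignment. -/
def IsFirstKind : Prop :=
  ∀ φ : Form, φ.IsL1 → ∀ v ρ : ℕ → A, ∃ a, Denotes v φ ρ a

variable (A) in
/-- Validity of `φ ≤ ψ` in `A`: the inequality holds under every assignment. -/
def ValidIn (φ ψ : Form) : Prop :=
  ∀ (v ρ : ℕ → A) (a b : A), Denotes v φ ρ a → Denotes v ψ ρ b → a ≤ b

end Algebra

/-! ## Canonical extensions -/

section CanonicalExtension

/-- Completely join-irreducible elements of a complete lattice. -/
def IsCJI {C : Type v} [CompleteLattice C] (j : C) : Prop :=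
  ∀ S : Set C, j = sSup S → j ∈ S

/-- Completely meet-irreducible elements of a complete lattice. -/
def IsCMI {C : Type v} [CompleteLattice C] (m : C) : Prop :=
  ∀ S : Set C, m = sInf S → m ∈ S

variable {A : Type u} {C : Type v}

/-- The closed elements: meets of elements of the original lattice. -/
def IsClosedElt [CompleteLattice C] (e : A → C) (c : C) : Prop := ∃ S : Set A, c = sInf (e '' S)

/-- The open elements: joins of elements of the original lattice. -/
def IsOpenElt [CompleteLattice C] (e : A → C) (c : C) : Prop := ∃ S : Set A, c = sSup (e '' S)

/-- The embedding `e` of the bounded distributive lattice `A` in the completely distributive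
complete lattice `C` is a canonical extension: it is dense and compact. -/
structure IsCanonicalExtension [DistribLattice A] [BoundedOrder A] [CompletelyDistribLattice C]
    (e : BoundedLatticeHom A C) : Prop where
  injective : Function.Injective e
  dense_join : ∀ c : C, ∃ K : Set C, (∀ k ∈ K, IsClosedElt e k) ∧ c = sSup K
  dense_meet : ∀ c : C, ∃ U : Set C, (∀ u ∈ U, IsOpenElt e u) ∧ c = sInf U
  compact : ∀ S T : Set A, sInf (e '' S) ≤ sSup (e '' T) →
    ∃ S' T' : Finset A, (S' : Set A) ⊆ S ∧ (T' : Set A) ⊆ T ∧ S'.inf e ≤ T'.sup e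

/-- The sigma-extension of a map on `A` to the canonical extension. -/
def sigmaExt [CompleteLattice C] (e : A → C) (f : A → A) (c : C) : C :=
  sSup {d | ∃ k u, IsClosedElt e k ∧ IsOpenElt e u ∧ k ≤ c ∧ c ≤ u ∧
    d = sInf {x | ∃ a, k ≤ e a ∧ e a ≤ u ∧ x = e (f a)}}

/-- The pi-extension of a map on `A` to the canonical extension. -/
def piExt [CompleteLattice C] (e : A → C) (f : A → A) (c : C) : C :=
  sInf {d | ∃ k u, IsClosedElt e k ∧ IsOpenElt e u ∧ k ≤ c ∧ c ≤ u ∧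
    d = sSup {x | ∃ a, k ≤ e a ∧ e a ≤ u ∧ x = e (f a)}}

variable [ModalBiHeyting A] [CompletelyDistribLattice C]

/-- The diamond of the canonical extension. -/
def diaExt (e : A → C) : C → C := sigmaExt e ModalBiHeyting.dia

/-- The box of the canonical extension. -/
def boxExt (e : A → C) : C → C := piExt e ModalBiHeyting.box

/-- The right adjoint of the diamond of the canonical extension. -/
def bboxExt (e : A → C) (c : C) : C := sSup {d | diaExt e d ≤ c}

/-- The left adjoint of the box of the canonical extension. -/
def bdiaExt (e : A → C) (c : C) : C := sInf {d | c ≤ boxExt e d}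

/-- An assignment on a complete lattice sends propositional variables to arbitrary elements,
nominals to completely join-irreducible and co-nominals to completely meet-irreducible elements. -/
structure Assignment (C : Type v) [CompleteLattice C] where
  prop : ℕ → C
  nom : ℕ → C
  cnom : ℕ → C
  nom_cji : ∀ j, IsCJI (nom j)
  cnom_cmi : ∀ m, IsCMI (cnom m)

/-- The value of a formula in the canonical extension. The plain binders are interpreted by all
pre- and post-fixed points in `C`, the starred binders only by those that come from `A`. -/
def eval (e : A → C) (V : Assignment C) : Form → (ℕ → C) → C
  | .bot, _ => ⊥
  | .top, _ => ⊤
  | .prop p, _ => V.prop p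
  | .fvar X, ρ => ρ X
  | .nom j, _ => V.nom j
  | .cnom m, _ => V.cnom m
  | .and φ ψ, ρ => eval e V φ ρ ⊓ eval e V ψ ρ
  | .or φ ψ, ρ => eval e V φ ρ ⊔ eval e V ψ ρ
  | .imp φ ψ, ρ => eval e V φ ρ ⇨ eval e V ψ ρ
  | .sub φ ψ, ρ => eval e V φ ρ \ eval e V ψ ρ
  | .dia φ, ρ => diaExt e (eval e V φ ρ)
  | .box φ, ρ => boxExt e (eval e V φ ρ)
  | .bbox φ, ρ => bboxExt e (eval e V φ ρ)
  | .bdia φ, ρ => bdiaExt e (eval e V φ ρ)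
  | .mu X φ, ρ => sInf {c | eval e V φ (Function.update ρ X c) ≤ c}
  | .nu X φ, ρ => sSup {c | c ≤ eval e V φ (Function.update ρ X c)}
  | .muS X φ, ρ => sInf (e '' {a | eval e V φ (Function.update ρ X (e a)) ≤ e a})
  | .nuS X φ, ρ => sSup (e '' {a | e a ≤ eval e V φ (Function.update ρ X (e a))})

/-- Validity of `φ ≤ ψ` in the canonical extension: it holds under every assignment. -/
def ValidInExt (e : A → C) (φ ψ : Form) : Prop :=
  ∀ (V : Assignment C) (ρ : ℕ → C), eval e V φ ρ ≤ eval e V ψ ρ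

end CanonicalExtension

/-- `φ ≤ ψ` is tame canonical: for every mu-algebra `A` of the first kind, with canonical extension
`e : A → C`, the inequality is valid in `A` iff its starred version is valid in `C`. -/
def IsTameCanonical (φ ψ : Form) : Prop :=
  ∀ (A : Type u) [ModalBiHeyting A], IsFirstKind A →
    ∀ (C : Type v) [CompletelyDistribLattice C] (e : BoundedLatticeHom A C),
      IsCanonicalExtension e → (ValidIn A φ ψ ↔ ValidInExt e φ.star ψ.star)

/-- Every bounded distributive lattice has a canonical extension: the lattice of down-sets of prime
ideals. So the quantification over canonical extensions above is never empty. -/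
theorem exists_isCanonicalExtension (A : Type u) [DistribLattice A] [BoundedOrder A] :
    ∃ e : BoundedLatticeHom A (LowerSet {I : Order.Ideal A // I.IsPrime}),
      IsCanonicalExtension e := by
  let e : BoundedLatticeHom A (LowerSet {I : Order.Ideal A // I.IsPrime}) :=
    { toFun := fun a => ⟨{I | a ∉ I.1}, fun I J hJI ha hJ => ha (hJI hJ)⟩
      map_sup' := fun a b => by
        ext I
        change a ⊔ b ∉ I.1 ↔ a ∉ I.1 ∨ b ∉ I.1
        rw [Order.Ideal.sup_mem_iff, not_and_or]
      map_inf' := fun a b => by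
        ext I
        have h : a ⊓ b ∈ I.1 ↔ a ∈ I.1 ∨ b ∈ I.1 :=
          ⟨I.2.mem_or_mem, fun h => h.elim (I.1.lower inf_le_left) (I.1.lower inf_le_right)⟩
        change a ⊓ b ∉ I.1 ↔ a ∉ I.1 ∧ b ∉ I.1
        rw [h, not_or]
      map_top' := by
        ext I
        exact iff_of_true I.2.toIsProper.top_notMem trivial
      map_bot' := by
        ext I
        simp }
  have he : ∀ a I, I ∈ e a ↔ a ∉ I.1 := fun a I => Iff.rfl
  have hcompact : ∀ S T : Set A, sInf (e '' S) ≤ sSup (e '' T) →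
      ∃ S' T' : Finset A, (S' : Set A) ⊆ S ∧ (T' : Set A) ⊆ T ∧ S'.inf id ≤ T'.sup id := by
    classical
    intro S T hST
    by_contra! hno
    let F : Order.PFilter A := Order.IsPFilter.toPFilter
      (F := {x | ∃ S' : Finset A, (S' : Set A) ⊆ S ∧ S'.inf id ≤ x}) (by
        refine Order.IsPFilter.of_def ⟨⊤, ∅, by simp, le_top⟩ ?_ ?_
        · rintro x ⟨S₁, h₁, hx⟩ y ⟨S₂, h₂, hy⟩
          exact ⟨x ⊓ y, ⟨S₁ ∪ S₂, by simp [h₁, h₂],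
            by rw [Finset.inf_union]; exact inf_le_inf hx hy⟩, inf_le_left, inf_le_right⟩
        · rintro x y hxy ⟨S₁, h₁, hx⟩
          exact ⟨S₁, h₁, hx.trans hxy⟩)
    let I : Order.Ideal A := Order.IsIdeal.toIdeal
      (I := {x | ∃ T' : Finset A, (T' : Set A) ⊆ T ∧ x ≤ T'.sup id}) (by
        refine ⟨?_, ⟨⊥, ∅, by simp, bot_le⟩, ?_⟩
        · rintro x y hxy ⟨T₁, h₁, hx⟩
          exact ⟨T₁, h₁, le_trans hxy hx⟩
        · rintro x ⟨T₁, h₁, hx⟩ y ⟨T₂, h₂, hy⟩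
          exact ⟨x ⊔ y, ⟨T₁ ∪ T₂, by simp [h₁, h₂],
            by rw [Finset.sup_union]; exact sup_le_sup hx hy⟩, le_sup_left, le_sup_right⟩)
    have hFI : Disjoint (F : Set A) (I : Set A) := by
      rw [Set.disjoint_left]
      rintro x ⟨S', hS', hx⟩ ⟨T', hT', hx'⟩
      exact hno S' T' hS' hT' (hx.trans hx')
    obtain ⟨J, hJ, hIJ, hFJ⟩ := DistribLattice.prime_ideal_of_disjoint_filter_ideal hFI
    have h1 : (⟨J, hJ⟩ : {I : Order.Ideal A // I.IsPrime}) ∈ sInf (e '' S) := by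
      rw [LowerSet.mem_sInf_iff]
      rintro _ ⟨a, ha, rfl⟩
      rw [he]
      exact Set.disjoint_left.1 hFJ ⟨{a}, by simpa using ha, by simp⟩
    obtain ⟨_, ⟨b, hb, rfl⟩, h2⟩ := LowerSet.mem_sSup_iff.1 (hST h1)
    rw [he] at h2
    exact h2 (hIJ ⟨{b}, by simpa using hb, by simp⟩)
  refine ⟨e, ?_, ?_, ?_, ?_⟩
  · have key : ∀ a b, e a ≤ e b → a ≤ b := by
      intro a b hab
      obtain ⟨S', T', hS, hT, h⟩ := hcompact {a} {b} (by simpa using hab)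
      refine le_trans (Finset.le_inf fun x hx => ?_) (h.trans (Finset.sup_le fun x hx => ?_))
      · exact (hS hx : x = a) ▸ le_rfl
      · exact (hT hx : x = b) ▸ le_rfl
    exact fun a b hab => le_antisymm (key a b hab.le) (key b a hab.ge)
  · intro c
    refine ⟨{k | ∃ I ∈ c, k = sInf (e '' {a | a ∉ I.1})}, ?_, ?_⟩
    · rintro _ ⟨I, _, rfl⟩
      exact ⟨_, rfl⟩
    · ext J
      simp only [SetLike.mem_coe, LowerSet.mem_sSup_iff]
      constructor
      · intro hJ
        refine ⟨_, ⟨J, hJ, rfl⟩, ?_⟩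
        rw [LowerSet.mem_sInf_iff]
        rintro _ ⟨a, ha, rfl⟩
        exact ha
      · rintro ⟨_, ⟨I, hI, rfl⟩, hJ⟩
        rw [LowerSet.mem_sInf_iff] at hJ
        refine c.lower (show J ≤ I from fun a ha => ?_) hI
        by_contra hn
        exact hJ _ ⟨a, hn, rfl⟩ ha
  · intro c
    refine ⟨{k | ∃ I, I ∉ c ∧ k = sSup (e '' {a | a ∈ I.1})}, ?_, ?_⟩
    · rintro _ ⟨I, _, rfl⟩
      exact ⟨_, rfl⟩
    · ext J
      simp only [SetLike.mem_coe, LowerSet.mem_sInf_iff]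
      constructor
      · rintro hJ _ ⟨I, hI, rfl⟩
        rw [LowerSet.mem_sSup_iff]
        by_contra! hn
        refine hI (c.lower (show I ≤ J from fun a ha => ?_) hJ)
        by_contra hn'
        exact hn _ ⟨a, ha, rfl⟩ hn'
      · intro h
        by_contra hJ
        obtain ⟨_, ⟨a, ha, rfl⟩, h2⟩ := LowerSet.mem_sSup_iff.1 (h _ ⟨J, hJ, rfl⟩)
        exact h2 ha
  · intro S T hST
    obtain ⟨S', T', hS, hT, h⟩ := hcompact S T hST
    refine ⟨S', T', hS, hT, ?_⟩
    have := OrderHomClass.mono e h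
    rwa [map_finset_inf, map_finset_sup] at this

/-! ## Tame runs of the algorithm -/

/-- An inequality `lhs ≤ rhs`. -/
structure Ineq where
  lhs : Form
  rhs : Form

/-- `Distrib s φ φ'`: in the generation tree of `φ` with root sign `s`, one positive occurrence of
`◇` or `∧` is distributed over a positive occurrence of `∨`, or one negative occurrence of `□` or
`∨` is distributed over a negative occurrence of `∧`, which results in `φ'`. -/
inductive Distrib : Bool → Form → Form → Prop
  | dia_or (α β) : Distrib true (.dia (.or α β)) (.or (.dia α) (.dia β))
  | and_or_left (α β γ) :
      Distrib true (.and (.or α β) γ) (.or (.and α γ) (.and β γ))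
  | and_or_right (α β γ) :
      Distrib true (.and γ (.or α β)) (.or (.and γ α) (.and γ β))
  | box_and (α β) : Distrib false (.box (.and α β)) (.and (.box α) (.box β))
  | or_and_left (α β γ) :
      Distrib false (.or (.and α β) γ) (.and (.or α γ) (.or β γ))
  | or_and_right (α β γ) :
      Distrib false (.or γ (.and α β)) (.and (.or γ α) (.or γ β))
  | and_left {s φ φ'} (ψ) : Distrib s φ φ' → Distrib s (.and φ ψ) (.and φ' ψ)
  | and_right {s φ φ'} (ψ) : Distrib s φ φ' → Distrib s (.and ψ φ) (.and ψ φ')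
  | or_left {s φ φ'} (ψ) : Distrib s φ φ' → Distrib s (.or φ ψ) (.or φ' ψ)
  | or_right {s φ φ'} (ψ) : Distrib s φ φ' → Distrib s (.or ψ φ) (.or ψ φ')
  | imp_left {s φ φ'} (ψ) : Distrib (!s) φ φ' → Distrib s (.imp φ ψ) (.imp φ' ψ)
  | imp_right {s φ φ'} (ψ) : Distrib s φ φ' → Distrib s (.imp ψ φ) (.imp ψ φ')
  | sub_left {s φ φ'} (ψ) : Distrib s φ φ' → Distrib s (.sub φ ψ) (.sub φ' ψ)
  | sub_right {s φ φ'} (ψ) : Distrib (!s) φ φ' → Distrib s (.sub ψ φ) (.sub ψ φ')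
  | dia {s φ φ'} : Distrib s φ φ' → Distrib s (.dia φ) (.dia φ')
  | box {s φ φ'} : Distrib s φ φ' → Distrib s (.box φ) (.box φ')
  | mu {s φ φ'} (X) : Distrib s φ φ' → Distrib s (.mu X φ) (.mu X φ')
  | nu {s φ φ'} (X) : Distrib s φ φ' → Distrib s (.nu X φ) (.nu X φ')

/-- One preprocessing transformation, which turns an inequality into a list of inequalities. -/
inductive PreRule : Ineq → List Ineq → Prop
  | distrib_left {φ φ' ψ} : Distrib true φ φ' → PreRule ⟨φ, ψ⟩ [⟨φ', ψ⟩]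
  | distrib_right {φ ψ ψ'} : Distrib false ψ ψ' → PreRule ⟨φ, ψ⟩ [⟨φ, ψ'⟩]
  | orLA (α β γ) : PreRule ⟨.or α β, γ⟩ [⟨α, γ⟩, ⟨β, γ⟩]
  | andRA (α β γ) : PreRule ⟨α, .and β γ⟩ [⟨α, β⟩, ⟨α, γ⟩]
  | botElim {α β} (p) : α.NegIn p → β.PosIn p →
      PreRule ⟨α, β⟩ [⟨Form.subst p .bot α, Form.subst p .bot β⟩]
  | topElim {α β} (p) : α.PosIn p → β.NegIn p →
      PreRule ⟨α, β⟩ [⟨Form.subst p .top α, Form.subst p .top β⟩]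

/-- A preprocessing step applies a preprocessing transformation to one inequality of the list. -/
inductive PreStep : List Ineq → List Ineq → Prop
  | mk {I L} (L₁ L₂) : PreRule I L → PreStep (L₁ ++ I :: L₂) (L₁ ++ L ++ L₂)

/-- A quasi-inequality: the conjunction of the inequalities `ante` implies `cons`. -/
structure QuasiIneq where
  ante : Multiset Ineq
  cons : Ineq

namespace Ineq

/-- The propositional variable `p` does not occur. -/
def PropFree (p : ℕ) (I : Ineq) : Prop := p ∉ I.lhs.props ∧ p ∉ I.rhs.props

/-- The nominal `j` does not occur. -/
def NomFree (j : ℕ) (I : Ineq) : Prop := j ∉ I.lhs.noms ∧ j ∉ I.rhs.noms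

/-- The co-nominal `m` does not occur. -/
def CnomFree (m : ℕ) (I : Ineq) : Prop := m ∉ I.lhs.cnoms ∧ m ∉ I.rhs.cnoms

/-- An inequality without propositional variables. -/
def IsPure (I : Ineq) : Prop := I.lhs.props = ∅ ∧ I.rhs.props = ∅

/-- Substitution for a propositional variable on both sides. -/
def subst (p : ℕ) (α : Form) (I : Ineq) : Ineq := ⟨Form.subst p α I.lhs, Form.subst p α I.rhs⟩

end Ineq

namespace QuasiIneq

/-- The nominal `j` is fresh for the quasi-inequality. -/
def NomFresh (j : ℕ) (Q : QuasiIneq) : Prop := (∀ I ∈ Q.ante, I.NomFree j) ∧ Q.cons.NomFree j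

/-- The co-nominal `m` is fresh for the quasi-inequality. -/
def CnomFresh (m : ℕ) (Q : QuasiIneq) : Prop := (∀ I ∈ Q.ante, I.CnomFree m) ∧ Q.cons.CnomFree m

/-- A pure quasi-inequality contains no propositional variables. -/
def IsPure (Q : QuasiIneq) : Prop := (∀ I ∈ Q.ante, I.IsPure) ∧ Q.cons.IsPure

end QuasiIneq

/-- First approximation, applied to the starred version of an inequality. -/
def firstApprox (j m : ℕ) (I : Ineq) : QuasiIneq :=
  ⟨{⟨.nom j, I.lhs.star⟩, ⟨I.rhs.star, .cnom m⟩}, ⟨.nom j, .cnom m⟩⟩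

/-- The residuation and adjunction rules: an inequality is replaced by a conjunction of
inequalities. The residuation rules for `∧` and `∨` may be applied in either argument. -/
inductive LocalRule : Ineq → Multiset Ineq → Prop
  | subLR (χ ψ φ) : LocalRule ⟨.sub χ ψ, φ⟩ {⟨χ, .or ψ φ⟩}
  | impRR (φ χ ψ) : LocalRule ⟨φ, .imp χ ψ⟩ {⟨.and φ χ, ψ⟩}
  | andLR (χ ψ φ) : LocalRule ⟨.and χ ψ, φ⟩ {⟨χ, .imp ψ φ⟩}
  | andLR' (χ ψ φ) : LocalRule ⟨.and χ ψ, φ⟩ {⟨ψ, .imp χ φ⟩}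
  | orRR (φ χ ψ) : LocalRule ⟨φ, .or χ ψ⟩ {⟨.sub φ χ, ψ⟩}
  | orRR' (φ χ ψ) : LocalRule ⟨φ, .or χ ψ⟩ {⟨.sub φ ψ, χ⟩}
  | orLA (φ χ ψ) : LocalRule ⟨.or φ χ, ψ⟩ {⟨φ, ψ⟩, ⟨χ, ψ⟩}
  | andRA (ψ φ χ) : LocalRule ⟨ψ, .and φ χ⟩ {⟨ψ, φ⟩, ⟨ψ, χ⟩}
  | diaLA (φ ψ) : LocalRule ⟨.dia φ, ψ⟩ {⟨φ, .bbox ψ⟩}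
  | boxRA (φ ψ) : LocalRule ⟨φ, .box ψ⟩ {⟨.bdia φ, ψ⟩}

/-- One step of a tame run after first approximation: a residuation, adjunction, ordinary
approximation or Ackermann rule is applied to the antecedent of a quasi-inequality. The fixed point
approximation rules are absent, because a tame run does not use them. In the Ackermann rules, `R`
consists of the inequalities outside the scope of the quantified variable `p`. -/
inductive TameStep : QuasiIneq → QuasiIneq → Prop
  | loc {I S} (Γ : Multiset Ineq) (c : Ineq) : LocalRule I S →
      TameStep ⟨I ::ₘ Γ, c⟩ ⟨S + Γ, c⟩
  | boxAppr (ψ : Form) (m n : ℕ) (Γ : Multiset Ineq) (c : Ineq) :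
      QuasiIneq.CnomFresh n ⟨⟨.box ψ, .cnom m⟩ ::ₘ Γ, c⟩ →
      TameStep ⟨⟨.box ψ, .cnom m⟩ ::ₘ Γ, c⟩
        ⟨⟨.box (.cnom n), .cnom m⟩ ::ₘ ⟨ψ, .cnom n⟩ ::ₘ Γ, c⟩
  | diaAppr (ψ : Form) (j i : ℕ) (Γ : Multiset Ineq) (c : Ineq) :
      QuasiIneq.NomFresh i ⟨⟨.nom j, .dia ψ⟩ ::ₘ Γ, c⟩ →
      TameStep ⟨⟨.nom j, .dia ψ⟩ ::ₘ Γ, c⟩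
        ⟨⟨.nom j, .dia (.nom i)⟩ ::ₘ ⟨.nom i, ψ⟩ ::ₘ Γ, c⟩
  | impAppr (χ φ : Form) (m j n : ℕ) (Γ : Multiset Ineq) (c : Ineq) :
      QuasiIneq.NomFresh j ⟨⟨.imp χ φ, .cnom m⟩ ::ₘ Γ, c⟩ →
      QuasiIneq.CnomFresh n ⟨⟨.imp χ φ, .cnom m⟩ ::ₘ Γ, c⟩ →
      TameStep ⟨⟨.imp χ φ, .cnom m⟩ ::ₘ Γ, c⟩
        ⟨⟨.imp (.nom j) (.cnom n), .cnom m⟩ ::ₘ ⟨.nom j, χ⟩ ::ₘ ⟨φ, .cnom n⟩ ::ₘ Γ, c⟩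
  | subAppr (χ φ : Form) (i j n : ℕ) (Γ : Multiset Ineq) (c : Ineq) :
      QuasiIneq.NomFresh j ⟨⟨.nom i, .sub χ φ⟩ ::ₘ Γ, c⟩ →
      QuasiIneq.CnomFresh n ⟨⟨.nom i, .sub χ φ⟩ ::ₘ Γ, c⟩ →
      TameStep ⟨⟨.nom i, .sub χ φ⟩ ::ₘ Γ, c⟩
        ⟨⟨.nom i, .sub (.nom j) (.cnom n)⟩ ::ₘ ⟨.nom j, χ⟩ ::ₘ ⟨φ, .cnom n⟩ ::ₘ Γ, c⟩
  | rightAckermann (p : ℕ) (αs : List Form) (B R : Multiset Ineq) (c : Ineq) :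
      (∀ α ∈ αs, p ∉ α.props ∧ α.SynClosed) →
      (∀ I ∈ B, I.lhs.PosIn p ∧ I.lhs.SynClosed ∧ I.rhs.NegIn p ∧ I.rhs.SynOpen) →
      (∀ I ∈ R, I.PropFree p) → c.PropFree p →
      TameStep ⟨((αs.map fun α => (⟨α, .prop p⟩ : Ineq)) : Multiset Ineq) + B + R, c⟩
        ⟨B.map (Ineq.subst p (Form.bigOr αs)) + R, c⟩
  | leftAckermann (p : ℕ) (αs : List Form) (B R : Multiset Ineq) (c : Ineq) :
      (∀ α ∈ αs, p ∉ α.props ∧ α.SynOpen) →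
      (∀ I ∈ B, I.lhs.NegIn p ∧ I.lhs.SynClosed ∧ I.rhs.PosIn p ∧ I.rhs.SynOpen) →
      (∀ I ∈ R, I.PropFree p) → c.PropFree p →
      TameStep ⟨((αs.map fun α => (⟨.prop p, α⟩ : Ineq)) : Multiset Ineq) + B + R, c⟩
        ⟨B.map (Ineq.subst p (Form.bigAnd αs)) + R, c⟩

/-- Some tame run succeeds on the inequality `φ ≤ ψ`: preprocessing turns it into finitely many
inequalities, and from each of these, after starring and first approximation, finitely many steps
lead to a pure quasi-inequality. -/
def TameRunSucceeds (φ ψ : Form) : Prop :=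
  ∃ L : List Ineq, Relation.ReflTransGen PreStep [⟨φ, ψ⟩] L ∧
    ∀ I ∈ L, ∃ (j m : ℕ) (Q : QuasiIneq),
      Relation.ReflTransGen TameStep (firstApprox j m I) Q ∧ Q.IsPure

end MuALBA

/-! Call an assignment on `C` admissible if it sends propositional variables into `A`. In a
mu-algebra of the first kind, a formula and its starred version have the same value under admissible
assignments (`eval_star_of_denotes`): a fixed point computed in `A` is itself one of the pre- or
post-fixed points over which the starred binder ranges, so the bound is attained and `e` need not
preserve infinite meets or joins. Hence validity in `A` is validity of the starred inequality in `C`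
under admissible assignments. One direction of the theorem is then immediate; the other must pass
from admissible to arbitrary assignments.

A successful run makes that passage. Validity under admissible assignments travels forward along the
run (`TameStep.holds_of_admissible`). At a pure quasi-inequality the propositional variables no
longer matter, so validity becomes unrestricted, and unrestricted validity travels back
(`TameStep.holds_of_holds`). Apart from the Ackermann rules this needs only residuation, adjunction,
monotonicity and the fact that the completely irreducible elements separate points and are
completely prime (`exists_cji_cmi`, `IsCJI.exists_le`).

The Ackermann rules are the hard case of the forward direction, because the least admissible-looking
value of `p`, the join of the `α`, is closed but need not lie in `A`.
`ApproxFamily.exists_forall_ineq` repairs this: finitely many inequalities "closed below open" that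
hold at a closed value of `p` already hold at some element of `A` above it, and dually. The
underlying induction, `ApproxFamily.eval`, uses compactness at each connective. For `μ*` compactness
leaves finitely many pre-fixed points, all in `A`, so the induction hypothesis applies to the body
with fixed point variables valued in `A`; here it is essential that starred binders range over `A`
only.

Much of the theory of canonical extensions is proved for one side and transferred by
`IsCanonicalExtension.dual`. -/

namespace MuALBA

/-! ### Closed and open elements, compactness and interpolation. -/

section CanonicalExtension

variable {A : Type u} {C : Type v} [DistribLattice A] [BoundedOrder A] [CompletelyDistribLattice C]
  {e : BoundedLatticeHom A C}

/-- The order dual of a canonical extension is a canonical extension of the order dual. -/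
theorem IsCanonicalExtension.dual (he : IsCanonicalExtension e) :
    IsCanonicalExtension (BoundedLatticeHom.dual e) where
  injective := he.injective
  dense_join := he.dense_meet
  dense_meet := he.dense_join
  compact S T h := by
    obtain ⟨S', T', hS, hT, h'⟩ := he.compact T S h
    exact ⟨T', S', hT, hS, h'⟩

theorem IsCanonicalExtension.map_le_map_iff (he : IsCanonicalExtension e) {a b : A} :
    e a ≤ e b ↔ a ≤ b := by
  rw [← inf_eq_left, ← map_inf, he.injective.eq_iff, inf_eq_left]

theorem isClosedElt_map (a : A) : IsClosedElt e (e a) := ⟨{a}, by simp⟩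

theorem isOpenElt_map (a : A) : IsOpenElt e (e a) := ⟨{a}, by simp⟩

theorem IsClosedElt.eq_sInf {k : C} (hk : IsClosedElt e k) : k = sInf (e '' {a | k ≤ e a}) := by
  obtain ⟨S, rfl⟩ := hk
  refine le_antisymm (le_sInf ?_) (sInf_le_sInf (Set.image_mono fun a ha => ?_))
  · rintro _ ⟨a, ha, rfl⟩
    exact ha
  · exact sInf_le ⟨a, ha, rfl⟩

theorem IsOpenElt.eq_sSup {u : C} (hu : IsOpenElt e u) : u = sSup (e '' {a | e a ≤ u}) :=
  IsClosedElt.eq_sInf (e := BoundedLatticeHom.dual e) hu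

/-- Compactness for a set that is closed under finite meets. -/
theorem IsCanonicalExtension.exists_mem_le (he : IsCanonicalExtension e) {S : Set A}
    (htop : ⊤ ∈ S) (hinf : ∀ a ∈ S, ∀ b ∈ S, a ⊓ b ∈ S) {u : C} (hu : IsOpenElt e u)
    (h : sInf (e '' S) ≤ u) : ∃ a ∈ S, e a ≤ u := by
  obtain ⟨T, rfl⟩ := hu
  obtain ⟨S', T', hS, hT, h'⟩ := he.compact S T h
  refine ⟨S'.inf id, Finset.inf_induction htop hinf fun a ha => hS ha, ?_⟩
  rw [map_finset_inf]
  exact h'.trans (Finset.sup_le fun a ha => le_sSup ⟨a, hT ha, rfl⟩)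

/-- Compactness for a set that is closed under finite joins. -/
theorem IsCanonicalExtension.exists_mem_ge (he : IsCanonicalExtension e) {S : Set A}
    (hbot : ⊥ ∈ S) (hsup : ∀ a ∈ S, ∀ b ∈ S, a ⊔ b ∈ S) {k : C} (hk : IsClosedElt e k)
    (h : k ≤ sSup (e '' S)) : ∃ a ∈ S, k ≤ e a :=
  he.dual.exists_mem_le hbot hsup hk h

/-- A closed element and an open element above it are separated by an element of the algebra. -/
theorem IsCanonicalExtension.exists_between (he : IsCanonicalExtension e) {k u : C}
    (hk : IsClosedElt e k) (hu : IsOpenElt e u) (h : k ≤ u) : ∃ a, k ≤ e a ∧ e a ≤ u := by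
  refine he.exists_mem_le (S := {a | k ≤ e a}) (by simp) (fun a ha b hb => ?_) hu
    (hk.eq_sInf.ge.trans h)
  exact (le_inf ha hb).trans_eq (map_inf e a b).symm

/-- Density in usable form: most inequalities in `C` below are tested against open upper bounds or
closed lower bounds, where compactness applies. -/
theorem IsCanonicalExtension.le_of_forall_open (he : IsCanonicalExtension e) {c d : C}
    (h : ∀ u, IsOpenElt e u → d ≤ u → c ≤ u) : c ≤ d := by
  obtain ⟨U, hU, rfl⟩ := he.dense_meet d
  exact le_sInf fun u hu => h u (hU u hu) (sInf_le hu)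

theorem IsCanonicalExtension.le_of_forall_closed (he : IsCanonicalExtension e) {c d : C}
    (h : ∀ k, IsClosedElt e k → k ≤ c → k ≤ d) : c ≤ d :=
  he.dual.le_of_forall_open h

/-- Interpolation by elements of `A` below every open bound forces `c` to be the meet of the
elements of `A` above it. This is the test by which several operations are shown to preserve
closedness. -/
theorem IsCanonicalExtension.isClosedElt_of_forall_open (he : IsCanonicalExtension e) {c : C}
    (h : ∀ u, IsOpenElt e u → c ≤ u → ∃ a, c ≤ e a ∧ e a ≤ u) : IsClosedElt e c := by
  refine ⟨{a | c ≤ e a}, le_antisymm (le_sInf ?_) (he.le_of_forall_open fun u hu hcu => ?_)⟩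
  · rintro _ ⟨a, ha, rfl⟩
    exact ha
  · obtain ⟨a, hca, hau⟩ := h u hu hcu
    exact sInf_le_of_le ⟨a, hca, rfl⟩ hau

theorem IsCanonicalExtension.isOpenElt_of_forall_closed (he : IsCanonicalExtension e) {c : C}
    (h : ∀ k, IsClosedElt e k → k ≤ c → ∃ a, k ≤ e a ∧ e a ≤ c) : IsOpenElt e c :=
  he.dual.isClosedElt_of_forall_open fun k hk hkc =>
    (h k hk hkc).imp fun _ ha => ha.symm

theorem IsCanonicalExtension.isClosedElt_sup (he : IsCanonicalExtension e) {k l : C}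
    (hk : IsClosedElt e k) (hl : IsClosedElt e l) : IsClosedElt e (k ⊔ l) := by
  refine he.isClosedElt_of_forall_open fun u hu h => ?_
  obtain ⟨a, hka, hau⟩ := he.exists_between hk hu (le_sup_left.trans h)
  obtain ⟨b, hlb, hbu⟩ := he.exists_between hl hu (le_sup_right.trans h)
  exact ⟨a ⊔ b, by rw [map_sup]; exact sup_le_sup hka hlb, by rw [map_sup]; exact sup_le hau hbu⟩

theorem IsCanonicalExtension.isOpenElt_inf (he : IsCanonicalExtension e) {u w : C}
    (hu : IsOpenElt e u) (hw : IsOpenElt e w) : IsOpenElt e (u ⊓ w) :=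
  he.dual.isClosedElt_sup hu hw

/-- A meet of two closed elements below an open element is witnessed in the algebra. -/
theorem IsCanonicalExtension.exists_inf_le (he : IsCanonicalExtension e) {k l u : C}
    (hk : IsClosedElt e k) (hl : IsClosedElt e l) (hu : IsOpenElt e u) (h : k ⊓ l ≤ u) :
    ∃ a b, k ≤ e a ∧ l ≤ e b ∧ e (a ⊓ b) ≤ u := by
  -- Taking `⊤` for `a` or for `b` puts all elements above `k` and all elements above `l` into this
  -- set, which is closed under finite meets.
  have key : sInf (e '' {c | ∃ a b, k ≤ e a ∧ l ≤ e b ∧ a ⊓ b ≤ c}) ≤ u := by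
    refine le_trans (le_inf ?_ ?_) h
    · conv_rhs => rw [hk.eq_sInf]
      exact sInf_le_sInf (Set.image_mono fun a ha => ⟨a, ⊤, ha, by simp, by simp⟩)
    · conv_rhs => rw [hl.eq_sInf]
      exact sInf_le_sInf (Set.image_mono fun a ha => ⟨⊤, a, by simp, ha, by simp⟩)
  obtain ⟨c, ⟨a, b, ha, hb, hab⟩, hc⟩ := he.exists_mem_le
    (S := {c | ∃ a b, k ≤ e a ∧ l ≤ e b ∧ a ⊓ b ≤ c}) ⟨⊤, ⊤, by simp, by simp, by simp⟩
    (by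
      rintro c ⟨a, b, ha, hb, hab⟩ c' ⟨a', b', ha', hb', hab'⟩
      refine ⟨a ⊓ a', b ⊓ b', by rw [map_inf]; exact le_inf ha ha',
        by rw [map_inf]; exact le_inf hb hb', ?_⟩
      rw [inf_inf_inf_comm]
      exact inf_le_inf hab hab') hu key
  exact ⟨a, b, ha, hb, (he.map_le_map_iff.2 hab).trans hc⟩

theorem IsCanonicalExtension.exists_le_sup (he : IsCanonicalExtension e) {k u w : C}
    (hu : IsOpenElt e u) (hw : IsOpenElt e w) (hk : IsClosedElt e k) (h : k ≤ u ⊔ w) :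
    ∃ a b, e a ≤ u ∧ e b ≤ w ∧ k ≤ e (a ⊔ b) :=
  he.dual.exists_inf_le hu hw hk h

theorem IsCanonicalExtension.isClosedElt_inf (he : IsCanonicalExtension e) {k l : C}
    (hk : IsClosedElt e k) (hl : IsClosedElt e l) : IsClosedElt e (k ⊓ l) := by
  refine he.isClosedElt_of_forall_open fun u hu h => ?_
  obtain ⟨a, b, ha, hb, hab⟩ := he.exists_inf_le hk hl hu h
  exact ⟨a ⊓ b, by rw [map_inf]; exact inf_le_inf ha hb, hab⟩

theorem IsCanonicalExtension.isOpenElt_sup (he : IsCanonicalExtension e) {u w : C}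
    (hu : IsOpenElt e u) (hw : IsOpenElt e w) : IsOpenElt e (u ⊔ w) :=
  he.dual.isClosedElt_inf hu hw

/-! ### Completely irreducible elements -/

theorem IsCanonicalExtension.isClosedElt_of_isCJI (he : IsCanonicalExtension e) {j : C}
    (hj : IsCJI j) : IsClosedElt e j := by
  obtain ⟨K, hK, h⟩ := he.dense_join j
  exact hK j (hj K h)

theorem IsCanonicalExtension.isOpenElt_of_isCMI (he : IsCanonicalExtension e) {m : C}
    (hm : IsCMI m) : IsOpenElt e m :=
  he.dual.isClosedElt_of_isCJI hm

/-- Frame distributivity makes irreducible elements prime: `j` is the join of the elements `j ⊓ s`,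
hence equals one of them. -/
theorem IsCJI.exists_le {j : C} (hj : IsCJI j) {S : Set C} (h : j ≤ sSup S) : ∃ s ∈ S, j ≤ s := by
  have : j = sSup ((fun s => j ⊓ s) '' S) := by
    rw [sSup_image, ← inf_sSup_eq, inf_eq_left.2 h]
  obtain ⟨s, hs, hjs⟩ := hj _ this
  exact ⟨s, hs, inf_eq_left.1 hjs⟩

theorem IsCMI.exists_le {m : C} (hm : IsCMI m) {S : Set C} (h : sInf S ≤ m) : ∃ s ∈ S, s ≤ m :=
  IsCJI.exists_le (C := Cᵒᵈ) hm h

/-- The meet of the complement of a prime ideal is completely join-irreducible. -/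
theorem IsCanonicalExtension.isCJI_of_isPrime (he : IsCanonicalExtension e) {P : Order.Ideal A}
    (h : ¬ sInf (e '' {a | a ∉ P}) ≤ sSup (e '' {a | a ∈ P})) :
    IsCJI (sInf (e '' {a | a ∉ P})) := by
  intro S hS
  by_contra hn
  refine h ?_
  rw [hS]
  refine sSup_le fun s hs => ?_
  have hsle : s ≤ sInf (e '' {a | a ∉ P}) := hS ▸ le_sSup hs
  have hnle : ¬ sInf (e '' {a | a ∉ P}) ≤ s := fun hle => hn (le_antisymm hle hsle ▸ hs)
  by_contra hsm
  -- If an open `u` is not above the meet of the complement of `P`, then every element of `A` below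
  -- `u` lies in `P`, so `u`, and with it `s`, is below the join of `P`. Thus every proper part `s`
  -- is below that join.
  refine hnle (he.le_of_forall_open fun u hu hsu => ?_)
  by_contra hju
  refine hsm (hsu.trans ?_)
  rw [hu.eq_sSup]
  refine sSup_le_sSup (Set.image_mono fun a ha => ?_)
  by_contra haP
  exact hju (sInf_le_of_le ⟨a, haP, rfl⟩ ha)

theorem IsCanonicalExtension.isCMI_of_isPrime (he : IsCanonicalExtension e) {P : Order.Ideal A}
    (h : ¬ sInf (e '' {a | a ∉ P}) ≤ sSup (e '' {a | a ∈ P})) :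
    IsCMI (sSup (e '' {a | a ∈ P})) := by
  intro S hS
  by_contra hn
  refine h ?_
  rw [hS]
  refine le_sInf fun s hs => ?_
  have hsle : sSup (e '' {a | a ∈ P}) ≤ s := hS ▸ sInf_le hs
  have hnle : ¬ s ≤ sSup (e '' {a | a ∈ P}) := fun hle => hn (le_antisymm hsle hle ▸ hs)
  by_contra hsm
  refine hnle (he.le_of_forall_closed fun k hk hks => ?_)
  by_contra hkm
  refine hsm (le_trans ?_ hks)
  rw [hk.eq_sInf]
  refine sInf_le_sInf (Set.image_mono fun a ha haP => ?_)
  exact hkm (le_trans ha (le_sSup ⟨a, haP, rfl⟩))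

/-- Completely join-irreducible and completely meet-irreducible elements separate. -/
theorem IsCanonicalExtension.exists_cji_cmi (he : IsCanonicalExtension e) {c d : C}
    (h : ¬ c ≤ d) : ∃ j m : C, IsCJI j ∧ IsCMI m ∧ j ≤ c ∧ d ≤ m ∧ ¬ j ≤ m := by
  -- Density reduces the claim to a closed `k` and an open `u` with `k` not below `u`. Then the
  -- filter of elements above `k` misses the ideal of elements below `u`, and the prime ideal
  -- theorem separates them.
  obtain ⟨k, hk, hkc, hkd⟩ : ∃ k, IsClosedElt e k ∧ k ≤ c ∧ ¬ k ≤ d := by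
    by_contra! hn
    exact h (he.le_of_forall_closed hn)
  obtain ⟨u, hu, hdu, hku⟩ : ∃ u, IsOpenElt e u ∧ d ≤ u ∧ ¬ k ≤ u := by
    by_contra! hn
    exact hkd (he.le_of_forall_open hn)
  let F : Order.PFilter A := Order.IsPFilter.toPFilter (F := {a | k ≤ e a})
    (Order.IsPFilter.of_def ⟨⊤, by simp⟩
      (fun a ha b hb => ⟨a ⊓ b, (le_inf ha hb).trans_eq (map_inf e a b).symm,
        inf_le_left, inf_le_right⟩)
      (fun {a b} hab ha => le_trans ha (he.map_le_map_iff.2 hab)))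
  let I : Order.Ideal A := Order.IsIdeal.toIdeal (I := {a | e a ≤ u})
    { IsLowerSet := fun a b hab ha => (he.map_le_map_iff.2 hab).trans ha
      Nonempty := ⟨⊥, by simp⟩
      Directed := fun a ha b hb => ⟨a ⊔ b, (map_sup e a b).trans_le (sup_le ha hb),
        le_sup_left, le_sup_right⟩ }
  have hFI : Disjoint (F : Set A) (I : Set A) :=
    Set.disjoint_left.2 fun a (ha : k ≤ e a) (hb : e a ≤ u) => hku (ha.trans hb)
  obtain ⟨P, hP, hIP, hFP⟩ := DistribLattice.prime_ideal_of_disjoint_filter_ideal hFI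
  -- Otherwise compactness would give an element outside `P` below an element of `P`. Primality is
  -- what makes the complement closed under finite meets.
  have hjm : ¬ sInf (e '' {a | a ∉ P}) ≤ sSup (e '' {a | a ∈ P}) := by
    intro hle
    obtain ⟨a, haP, ha⟩ := he.exists_mem_le (S := {a | a ∉ P}) hP.toIsProper.top_notMem
      (fun a ha b hb hab => (hP.mem_or_mem hab).elim ha hb) ⟨_, rfl⟩ hle
    obtain ⟨b, hbP, hb⟩ := he.exists_mem_ge (S := {a | a ∈ P}) P.bot_mem
      (fun a ha b hb => P.sup_mem ha hb) (isClosedElt_map a) ha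
    exact haP (P.lower (he.map_le_map_iff.1 hb) hbP)
  refine ⟨_, _, he.isCJI_of_isPrime hjm, he.isCMI_of_isPrime hjm, le_trans ?_ hkc,
    hdu.trans ?_, hjm⟩
  · conv_rhs => rw [hk.eq_sInf]
    exact sInf_le_sInf (Set.image_mono fun a ha haP => Set.disjoint_left.1 hFP ha haP)
  · conv_lhs => rw [hu.eq_sSup]
    exact sSup_le_sSup (Set.image_mono fun a ha => hIP ha)

theorem IsCanonicalExtension.eq_sSup_cji (he : IsCanonicalExtension e) (c : C) :
    c = sSup {j | IsCJI j ∧ j ≤ c} := by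
  refine le_antisymm ?_ (sSup_le fun j hj => hj.2)
  by_contra h
  obtain ⟨j, m, hj, -, hjc, hm, hjm⟩ := he.exists_cji_cmi h
  exact hjm (sSup_le_iff.1 hm j ⟨hj, hjc⟩)

theorem IsCanonicalExtension.eq_sInf_cmi (he : IsCanonicalExtension e) (c : C) :
    c = sInf {m | IsCMI m ∧ c ≤ m} :=
  he.dual.eq_sSup_cji c

/-! ### Extensions of operators -/

variable {f : A → A}

theorem IsCanonicalExtension.sigmaExt_le_iff (he : IsCanonicalExtension e) (hf : Monotone f)
    {c u : C} (hu : IsOpenElt e u) :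
    sigmaExt e f c ≤ u ↔ ∀ k, IsClosedElt e k → k ≤ c → ∃ a, k ≤ e a ∧ e (f a) ≤ u := by
  constructor
  · intro h k hk hkc
    -- Closing the set of values upwards makes it closed under finite meets although `f` is only
    -- monotone. The definition is used with `⊤` as the open upper bound.
    have hle : sInf (e '' {b | ∃ a, k ≤ e a ∧ f a ≤ b}) ≤ u := by
      refine le_trans ?_
        (sSup_le_iff.1 h _ ⟨k, ⊤, hk, ⟨{⊤}, by simp⟩, hkc, le_top, rfl⟩)
      refine le_sInf ?_
      rintro _ ⟨a, ha, -, rfl⟩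
      exact sInf_le ⟨f a, ⟨a, ha, le_rfl⟩, rfl⟩
    obtain ⟨b, ⟨a, ha, hab⟩, hb⟩ := he.exists_mem_le
      (S := {b | ∃ a, k ≤ e a ∧ f a ≤ b}) ⟨⊤, by simp, le_top⟩
      (by
        rintro b ⟨a, ha, hab⟩ b' ⟨a', ha', hab'⟩
        exact ⟨a ⊓ a', by rw [map_inf]; exact le_inf ha ha',
          le_inf ((hf inf_le_left).trans hab) ((hf inf_le_right).trans hab')⟩) hu hle
    exact ⟨a, ha, (he.map_le_map_iff.2 hab).trans hb⟩
  · intro h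
    refine sSup_le ?_
    rintro _ ⟨k, w, hk, hw, hkc, hcw, rfl⟩
    obtain ⟨a, ha, hau⟩ := h k hk hkc
    -- The definition admits only elements below `w`, so the witness `a` is cut down by an
    -- interpolant `b`.
    obtain ⟨b, hb, hbw⟩ := he.exists_between hk hw (hkc.trans hcw)
    refine sInf_le_of_le ⟨a ⊓ b, ?_, ?_, rfl⟩
      ((he.map_le_map_iff.2 (hf inf_le_left)).trans hau)
    · rw [map_inf]
      exact le_inf ha hb
    · rw [map_inf]
      exact inf_le_right.trans hbw

/-- The working form of the definition of the sigma-extension: compactness replaces each infinite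
meet below an open bound by a single value of `f`. -/
theorem IsCanonicalExtension.sigmaExt_mono (he : IsCanonicalExtension e) (hf : Monotone f) :
    Monotone (sigmaExt e f) := fun _ _ hcd => he.le_of_forall_open fun _ hu h =>
  (he.sigmaExt_le_iff hf hu).2 fun k hk hkc =>
    (he.sigmaExt_le_iff hf hu).1 h k hk (hkc.trans hcd)

theorem IsCanonicalExtension.sigmaExt_closed_le_iff (he : IsCanonicalExtension e)
    (hf : Monotone f) {k u : C} (hk : IsClosedElt e k) (hu : IsOpenElt e u) :
    sigmaExt e f k ≤ u ↔ ∃ a, k ≤ e a ∧ e (f a) ≤ u := by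
  rw [he.sigmaExt_le_iff hf hu]
  exact ⟨fun h => h k hk le_rfl, fun ⟨a, ha, hau⟩ l _ hlk => ⟨a, hlk.trans ha, hau⟩⟩

theorem IsCanonicalExtension.sigmaExt_map (he : IsCanonicalExtension e) (hf : Monotone f)
    (a : A) : sigmaExt e f (e a) = e (f a) := by
  refine le_antisymm ((he.sigmaExt_closed_le_iff hf (isClosedElt_map a) (isOpenElt_map _)).2
    ⟨a, le_rfl, le_rfl⟩) (he.le_of_forall_open fun u hu h => ?_)
  obtain ⟨b, hab, hb⟩ := (he.sigmaExt_closed_le_iff hf (isClosedElt_map a) hu).1 h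
  exact (he.map_le_map_iff.2 (hf (he.map_le_map_iff.1 hab))).trans hb

theorem IsCanonicalExtension.isClosedElt_sigmaExt (he : IsCanonicalExtension e)
    (hf : Monotone f) {k : C} (hk : IsClosedElt e k) : IsClosedElt e (sigmaExt e f k) := by
  refine he.isClosedElt_of_forall_open fun u hu h => ?_
  obtain ⟨a, ha, hau⟩ := (he.sigmaExt_closed_le_iff hf hk hu).1 h
  exact ⟨f a, (he.sigmaExt_mono hf ha).trans_eq (he.sigmaExt_map hf a), hau⟩

theorem IsCanonicalExtension.sigmaExt_open (he : IsCanonicalExtension e)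
    (hf : Monotone f) {u : C} (hu : IsOpenElt e u) :
    sigmaExt e f u = sSup (e '' {b | ∃ a, e a ≤ u ∧ b ≤ f a}) := by
  refine le_antisymm (he.le_of_forall_open fun w hw h => ?_) (sSup_le ?_)
  · refine (he.sigmaExt_le_iff hf hw).2 fun k hk hku => ?_
    obtain ⟨a, ha, hau⟩ := he.exists_between hk hu hku
    exact ⟨a, ha, sSup_le_iff.1 h _ ⟨f a, ⟨a, hau, le_rfl⟩, rfl⟩⟩
  · rintro _ ⟨b, ⟨a, ha, hab⟩, rfl⟩
    exact (he.map_le_map_iff.2 hab).trans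
      ((he.sigmaExt_map hf a).ge.trans (he.sigmaExt_mono hf ha))

theorem IsCanonicalExtension.isOpenElt_sigmaExt (he : IsCanonicalExtension e)
    (hf : Monotone f) {u : C} (hu : IsOpenElt e u) : IsOpenElt e (sigmaExt e f u) :=
  ⟨_, he.sigmaExt_open hf hu⟩

theorem IsCanonicalExtension.le_sigmaExt_open (he : IsCanonicalExtension e)
    (hf : Monotone f) {k u : C} (hu : IsOpenElt e u) (hk : IsClosedElt e k)
    (h : k ≤ sigmaExt e f u) : ∃ a, e a ≤ u ∧ k ≤ e (f a) := by
  rw [he.sigmaExt_open hf hu] at h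
  obtain ⟨b, ⟨a, ha, hab⟩, hb⟩ := he.exists_mem_ge
    (S := {b | ∃ a, e a ≤ u ∧ b ≤ f a}) ⟨⊥, by simp, bot_le⟩
    (by
      rintro b ⟨a, ha, hab⟩ b' ⟨a', ha', hab'⟩
      exact ⟨a ⊔ a', by rw [map_sup]; exact sup_le ha ha',
        sup_le (hab.trans (hf le_sup_left)) (hab'.trans (hf le_sup_right))⟩) hk h
  exact ⟨a, ha, hb.trans (he.map_le_map_iff.2 hab)⟩

/-- The sigma-extension of an operator that preserves finite joins has a right adjoint. -/
theorem IsCanonicalExtension.gc_sigmaExt (he : IsCanonicalExtension e) (hbot : f ⊥ = ⊥)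
    (hsup : ∀ a b, f (a ⊔ b) = f a ⊔ f b) :
    GaloisConnection (sigmaExt e f) fun c => sSup {d | sigmaExt e f d ≤ c} := by
  have hf : Monotone f := fun a b hab => by
    rw [← sup_eq_right.2 hab, hsup]
    exact le_sup_left
  intro d c
  refine ⟨fun h => le_sSup h, fun h => (he.sigmaExt_mono hf h).trans ?_⟩
  refine he.le_of_forall_open fun u hu hcu => (he.sigmaExt_le_iff hf hu).2 fun k hk hkd => ?_
  -- Preservation of finite joins makes this set an ideal. Its join bounds every `d'` with `sigmaExt
  -- e f d' ≤ c`, so compactness gives one member above `k`.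
  refine he.exists_mem_ge (S := {a | e (f a) ≤ u}) (by simp [hbot]) (fun a ha b hb => ?_) hk
    (hkd.trans (sSup_le fun d' hd' => he.le_of_forall_closed fun l hl hld => ?_)) |>.imp
      fun a ha => ha.symm
  · change e (f (a ⊔ b)) ≤ u
    rw [hsup, map_sup]
    exact sup_le ha hb
  · obtain ⟨a, ha, hau⟩ := (he.sigmaExt_le_iff hf hu).1 (hd'.trans hcu) l hl hld
    exact ha.trans (le_sSup ⟨a, hau, rfl⟩)

theorem IsCanonicalExtension.isOpenElt_rightAdjoint_sigmaExt (he : IsCanonicalExtension e)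
    (hbot : f ⊥ = ⊥) (hsup : ∀ a b, f (a ⊔ b) = f a ⊔ f b) {u : C} (hu : IsOpenElt e u) :
    IsOpenElt e (sSup {d | sigmaExt e f d ≤ u}) := by
  have hf : Monotone f := fun a b hab => by
    rw [← sup_eq_right.2 hab, hsup]
    exact le_sup_left
  refine he.isOpenElt_of_forall_closed fun k hk h => ?_
  obtain ⟨a, ha, hau⟩ := (he.sigmaExt_closed_le_iff hf hk hu).1
    ((he.gc_sigmaExt hbot hsup).le_iff_le.2 h)
  exact ⟨a, ha, le_sSup ((he.sigmaExt_map hf a).trans_le hau)⟩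

/-- The two definitions differ under duality only in the order of their conjuncts. All facts about
pi-extensions, and so about the box, follow from this. -/
theorem piExt_eq_sigmaExt_dual (f : A → A) (c : C) :
    piExt e f c = sigmaExt (A := Aᵒᵈ) (C := Cᵒᵈ) (BoundedLatticeHom.dual e) f c := by
  have hset : ∀ k u : C, {x | ∃ a, k ≤ e a ∧ e a ≤ u ∧ x = e (f a)} =
      {x | ∃ a, e a ≤ u ∧ k ≤ e a ∧ x = e (f a)} := fun k u =>
    Set.ext fun x => exists_congr fun a => and_left_comm
  refine congrArg (sInf : Set C → C) (Set.ext fun d => ?_)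
  constructor
  · rintro ⟨k, u, hk, hu, hkc, hcu, rfl⟩
    exact ⟨u, k, hu, hk, hcu, hkc, congrArg (sSup : Set C → C) (hset k u)⟩
  · rintro ⟨u, k, hu, hk, hcu, hkc, rfl⟩
    exact ⟨k, u, hk, hu, hkc, hcu, congrArg (sSup : Set C → C) (hset k u).symm⟩

theorem IsCanonicalExtension.piExt_map (he : IsCanonicalExtension e) (hf : Monotone f) (a : A) :
    piExt e f (e a) = e (f a) :=
  (piExt_eq_sigmaExt_dual f (e a)).trans (he.dual.sigmaExt_map hf.dual a)

theorem IsCanonicalExtension.isClosedElt_piExt (he : IsCanonicalExtension e) (hf : Monotone f)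
    {k : C} (hk : IsClosedElt e k) : IsClosedElt e (piExt e f k) := by
  rw [piExt_eq_sigmaExt_dual]
  exact he.dual.isOpenElt_sigmaExt hf.dual hk

theorem IsCanonicalExtension.isOpenElt_piExt (he : IsCanonicalExtension e) (hf : Monotone f)
    {u : C} (hu : IsOpenElt e u) : IsOpenElt e (piExt e f u) := by
  rw [piExt_eq_sigmaExt_dual]
  exact he.dual.isClosedElt_sigmaExt hf.dual hu

theorem IsCanonicalExtension.le_piExt_open_iff (he : IsCanonicalExtension e) (hf : Monotone f)
    {k u : C} (hu : IsOpenElt e u) (hk : IsClosedElt e k) :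
    k ≤ piExt e f u ↔ ∃ a, e a ≤ u ∧ k ≤ e (f a) := by
  rw [piExt_eq_sigmaExt_dual]
  exact he.dual.sigmaExt_closed_le_iff hf.dual hu hk

theorem IsCanonicalExtension.piExt_closed_le (he : IsCanonicalExtension e) (hf : Monotone f)
    {k u : C} (hk : IsClosedElt e k) (hu : IsOpenElt e u) (h : piExt e f k ≤ u) :
    ∃ a, k ≤ e a ∧ e (f a) ≤ u := by
  rw [piExt_eq_sigmaExt_dual] at h
  exact he.dual.le_sigmaExt_open hf.dual hk hu h

/-- The pi-extension of an operator that preserves finite meets has a left adjoint. -/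
theorem IsCanonicalExtension.gc_piExt (he : IsCanonicalExtension e) (htop : f ⊤ = ⊤)
    (hinf : ∀ a b, f (a ⊓ b) = f a ⊓ f b) :
    GaloisConnection (fun c => sInf {d | c ≤ piExt e f d}) (piExt e f) := fun c d => by
  simp only [piExt_eq_sigmaExt_dual]
  exact (he.dual.gc_sigmaExt htop hinf d c).symm

theorem IsCanonicalExtension.isClosedElt_leftAdjoint_piExt (he : IsCanonicalExtension e)
    (htop : f ⊤ = ⊤) (hinf : ∀ a b, f (a ⊓ b) = f a ⊓ f b) {k : C} (hk : IsClosedElt e k) :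
    IsClosedElt e (sInf {d | k ≤ piExt e f d}) := by
  simp only [piExt_eq_sigmaExt_dual]
  exact he.dual.isOpenElt_rightAdjoint_sigmaExt htop hinf hk

end CanonicalExtension

/-! ### Implication and subtraction on the canonical extension. -/

section Residuals

variable {A : Type u} {C : Type v} [BiheytingAlgebra A] [CompletelyDistribLattice C]
  {e : BoundedLatticeHom A C}

theorem IsCanonicalExtension.map_himp (he : IsCanonicalExtension e) (a b : A) :
    e (a ⇨ b) = e a ⇨ e b := by
  refine le_antisymm ?_ (he.le_of_forall_closed fun k hk h => ?_)
  · rw [le_himp_iff, ← map_inf]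
    exact he.map_le_map_iff.2 himp_inf_le
  · obtain ⟨c, d, hc, hd, hcd⟩ := he.exists_inf_le hk (isClosedElt_map a) (isOpenElt_map b)
      (le_himp_iff.1 h)
    refine hc.trans (he.map_le_map_iff.2 (le_himp_iff.2 ?_))
    exact (inf_le_inf_left _ (he.map_le_map_iff.1 hd)).trans (he.map_le_map_iff.1 hcd)

/-- Implication turns joins on the left and meets on the right into meets. The index set is closed
upwards so that compactness can be applied to it. -/
theorem IsCanonicalExtension.himp_eq_sInf (he : IsCanonicalExtension e) {u k : C}
    (hu : IsOpenElt e u) (hk : IsClosedElt e k) :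
    u ⇨ k = sInf (e '' {c | ∃ a b, e a ≤ u ∧ k ≤ e b ∧ a ⇨ b ≤ c}) := by
  refine le_antisymm (le_sInf ?_) ?_
  · rintro _ ⟨c, ⟨a, b, ha, hb, hc⟩, rfl⟩
    exact (himp_le_himp ha hb).trans ((he.map_himp a b).ge.trans (he.map_le_map_iff.2 hc))
  -- Residuation isolates `u` on the left, where it can be split as a join; the same exchange then
  -- exposes `k` on the right as a meet.
  · rw [le_himp_iff, inf_comm, ← le_himp_iff]
    conv_lhs => rw [hu.eq_sSup]
    refine sSup_le ?_
    rintro _ ⟨a, ha, rfl⟩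
    rw [le_himp_iff, inf_comm, ← le_himp_iff, hk.eq_sInf, le_himp_iff]
    refine le_sInf ?_
    rintro _ ⟨b, hb, rfl⟩
    rw [← le_himp_iff, ← he.map_himp, ← hk.eq_sInf]
    exact sInf_le ⟨_, ⟨a, b, ha, hb, le_rfl⟩, rfl⟩

theorem IsCanonicalExtension.isClosedElt_himp (he : IsCanonicalExtension e) {u k : C}
    (hu : IsOpenElt e u) (hk : IsClosedElt e k) : IsClosedElt e (u ⇨ k) :=
  ⟨_, he.himp_eq_sInf hu hk⟩

/-- Splitting an inequality at elements of `A`, one for each argument, is what the inductive step of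
`ApproxFamily.eval` needs for each connective. -/
theorem IsCanonicalExtension.exists_himp_le (he : IsCanonicalExtension e) {u k w : C}
    (hu : IsOpenElt e u) (hk : IsClosedElt e k) (hw : IsOpenElt e w) (h : u ⇨ k ≤ w) :
    ∃ a b, e a ≤ u ∧ k ≤ e b ∧ e a ⇨ e b ≤ w := by
  rw [he.himp_eq_sInf hu hk] at h
  obtain ⟨c, ⟨a, b, ha, hb, hc⟩, hcw⟩ := he.exists_mem_le
    (S := {c | ∃ a b, e a ≤ u ∧ k ≤ e b ∧ a ⇨ b ≤ c}) ⟨⊥, ⊤, by simp, by simp, le_top⟩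
    (by
      rintro c ⟨a, b, ha, hb, hc⟩ c' ⟨a', b', ha', hb', hc'⟩
      refine ⟨a ⊔ a', b ⊓ b', by rw [map_sup]; exact sup_le ha ha',
        by rw [map_inf]; exact le_inf hb hb', le_inf (le_trans ?_ hc) (le_trans ?_ hc')⟩
      · exact himp_le_himp le_sup_left inf_le_left
      · exact himp_le_himp le_sup_right inf_le_right) hw h
  exact ⟨a, b, ha, hb, (he.map_himp a b).ge.trans ((he.map_le_map_iff.2 hc).trans hcw)⟩

theorem IsCanonicalExtension.exists_le_himp (he : IsCanonicalExtension e) {k u l : C}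
    (hk : IsClosedElt e k) (hu : IsOpenElt e u) (hl : IsClosedElt e l) (h : l ≤ k ⇨ u) :
    ∃ a b, k ≤ e a ∧ e b ≤ u ∧ l ≤ e a ⇨ e b := by
  obtain ⟨c, a, hc, ha, hca⟩ := he.exists_inf_le hl hk hu (le_himp_iff.1 h)
  -- The element `c` itself need not be below `u`, but `c ⊓ a` is, and `a ⇨ c ⊓ a` still dominates
  -- `c`.
  refine ⟨a, c ⊓ a, ha, hca, le_himp_iff.2 ?_⟩
  rw [map_inf]
  exact inf_le_inf_right _ hc

theorem IsCanonicalExtension.isOpenElt_himp (he : IsCanonicalExtension e) {k u : C}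
    (hk : IsClosedElt e k) (hu : IsOpenElt e u) : IsOpenElt e (k ⇨ u) := by
  refine he.isOpenElt_of_forall_closed fun l hl h => ?_
  obtain ⟨a, b, ha, hb, hl⟩ := he.exists_le_himp hk hu hl h
  exact ⟨a ⇨ b, hl.trans_eq (he.map_himp a b).symm,
    (he.map_himp a b).trans_le (himp_le_himp ha hb)⟩

theorem IsCanonicalExtension.map_sdiff (he : IsCanonicalExtension e) (a b : A) :
    e (a \ b) = e a \ e b :=
  he.dual.map_himp (A := Aᵒᵈ) b a

theorem IsCanonicalExtension.isOpenElt_sdiff (he : IsCanonicalExtension e) {u k : C}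
    (hu : IsOpenElt e u) (hk : IsClosedElt e k) : IsOpenElt e (u \ k) :=
  he.dual.isClosedElt_himp (A := Aᵒᵈ) hk hu

theorem IsCanonicalExtension.exists_le_sdiff (he : IsCanonicalExtension e) {u k l : C}
    (hu : IsOpenElt e u) (hk : IsClosedElt e k) (hl : IsClosedElt e l) (h : l ≤ u \ k) :
    ∃ a b, e a ≤ u ∧ k ≤ e b ∧ l ≤ e a \ e b := by
  obtain ⟨b, a, hb, ha, h'⟩ := he.dual.exists_himp_le (A := Aᵒᵈ) hk hu hl h
  exact ⟨a, b, ha, hb, h'⟩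

theorem IsCanonicalExtension.isClosedElt_sdiff (he : IsCanonicalExtension e) {u k : C}
    (hk : IsClosedElt e k) (hu : IsOpenElt e u) : IsClosedElt e (k \ u) :=
  he.dual.isOpenElt_himp (A := Aᵒᵈ) hu hk

theorem IsCanonicalExtension.exists_sdiff_le (he : IsCanonicalExtension e) {u k w : C}
    (hk : IsClosedElt e k) (hu : IsOpenElt e u) (hw : IsOpenElt e w) (h : k \ u ≤ w) :
    ∃ a b, k ≤ e a ∧ e b ≤ u ∧ e a \ e b ≤ w := by
  obtain ⟨b, a, hb, ha, h'⟩ := he.dual.exists_le_himp (A := Aᵒᵈ) hu hk hw h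
  exact ⟨a, b, ha, hb, h'⟩

end Residuals

/-! ### Irreducible witnesses for the approximation rules of subtraction and implication. -/

section Irreducible

variable {A : Type u} {C : Type v} [DistribLattice A] [BoundedOrder A] [CompletelyDistribLattice C]
  {e : BoundedLatticeHom A C}

/-- It suffices that `c \ d` is below the join `s` of all admitted `j \ n`, since `i` is completely
join-prime. If `c` were not below `d ⊔ s`, separation would give `j ≤ c` and `m` above both `d` and
`s` with `j` not below `m`; but `j \ m` is one of the joinands, so `j \ m ≤ m`, which means `j ≤ m`.
-/
theorem IsCanonicalExtension.exists_sdiff_cji_cmi (he : IsCanonicalExtension e) {i c d : C}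
    (hi : IsCJI i) (h : i ≤ c \ d) :
    ∃ j n, IsCJI j ∧ IsCMI n ∧ i ≤ j \ n ∧ j ≤ c ∧ d ≤ n := by
  have hle : c \ d ≤ sSup {x | ∃ j n, IsCJI j ∧ IsCMI n ∧ j ≤ c ∧ d ≤ n ∧ x = j \ n} := by
    rw [sdiff_le_iff]
    by_contra hn
    obtain ⟨j, m, hj, hm, hjc, hdm, hjm⟩ := he.exists_cji_cmi hn
    have := sSup_le_iff.1 (le_sup_right.trans hdm) (j \ m)
      ⟨j, m, hj, hm, hjc, le_sup_left.trans hdm, rfl⟩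
    rw [sdiff_le_iff, sup_idem] at this
    exact hjm this
  obtain ⟨_, ⟨j, n, hj, hn, hjc, hdn, rfl⟩, hle'⟩ := hi.exists_le (h.trans hle)
  exact ⟨j, n, hj, hn, hle', hjc, hdn⟩

theorem IsCanonicalExtension.exists_himp_cji_cmi (he : IsCanonicalExtension e) {m c d : C}
    (hm : IsCMI m) (h : c ⇨ d ≤ m) :
    ∃ j n, IsCJI j ∧ IsCMI n ∧ j ⇨ n ≤ m ∧ j ≤ c ∧ d ≤ n := by
  obtain ⟨n, j, hn, hj, h₁, h₂, h₃⟩ := he.dual.exists_sdiff_cji_cmi hm h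
  exact ⟨j, n, hj, hn, h₁, h₃, h₂⟩

end Irreducible

/-! ### The modalities of the canonical extension and their adjoints. -/

section Modalities

variable {A : Type u} {C : Type v} [ModalBiHeyting A] [CompletelyDistribLattice C]
  {e : BoundedLatticeHom A C}

theorem dia_mono : Monotone (ModalBiHeyting.dia : A → A) := fun a b hab => by
  rw [← sup_eq_right.2 hab, ModalBiHeyting.dia_sup]
  exact le_sup_left

theorem box_mono : Monotone (ModalBiHeyting.box : A → A) := fun a b hab => by
  rw [← inf_eq_left.2 hab, ModalBiHeyting.box_inf]
  exact inf_le_right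

theorem IsCanonicalExtension.gc_dia_bbox (he : IsCanonicalExtension e) :
    GaloisConnection (diaExt e) (bboxExt e) :=
  he.gc_sigmaExt ModalBiHeyting.dia_bot ModalBiHeyting.dia_sup

theorem IsCanonicalExtension.gc_bdia_box (he : IsCanonicalExtension e) :
    GaloisConnection (bdiaExt e) (boxExt e) :=
  he.gc_piExt ModalBiHeyting.box_top ModalBiHeyting.box_inf

theorem IsCanonicalExtension.diaExt_map (he : IsCanonicalExtension e) (a : A) :
    diaExt e (e a) = e (ModalBiHeyting.dia a) :=
  he.sigmaExt_map dia_mono a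

theorem IsCanonicalExtension.boxExt_map (he : IsCanonicalExtension e) (a : A) :
    boxExt e (e a) = e (ModalBiHeyting.box a) :=
  he.piExt_map box_mono a

theorem IsCanonicalExtension.isClosedElt_diaExt (he : IsCanonicalExtension e) {k : C}
    (hk : IsClosedElt e k) : IsClosedElt e (diaExt e k) :=
  he.isClosedElt_sigmaExt dia_mono hk

theorem IsCanonicalExtension.isOpenElt_diaExt (he : IsCanonicalExtension e) {u : C}
    (hu : IsOpenElt e u) : IsOpenElt e (diaExt e u) :=
  he.isOpenElt_sigmaExt dia_mono hu

theorem IsCanonicalExtension.isClosedElt_boxExt (he : IsCanonicalExtension e) {k : C}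
    (hk : IsClosedElt e k) : IsClosedElt e (boxExt e k) :=
  he.isClosedElt_piExt box_mono hk

theorem IsCanonicalExtension.isOpenElt_boxExt (he : IsCanonicalExtension e) {u : C}
    (hu : IsOpenElt e u) : IsOpenElt e (boxExt e u) :=
  he.isOpenElt_piExt box_mono hu

theorem IsCanonicalExtension.isOpenElt_bboxExt (he : IsCanonicalExtension e) {u : C}
    (hu : IsOpenElt e u) : IsOpenElt e (bboxExt e u) :=
  he.isOpenElt_rightAdjoint_sigmaExt ModalBiHeyting.dia_bot ModalBiHeyting.dia_sup hu

theorem IsCanonicalExtension.isClosedElt_bdiaExt (he : IsCanonicalExtension e) {k : C}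
    (hk : IsClosedElt e k) : IsClosedElt e (bdiaExt e k) :=
  he.isClosedElt_leftAdjoint_piExt ModalBiHeyting.box_top ModalBiHeyting.box_inf hk

theorem IsCanonicalExtension.exists_diaExt_le (he : IsCanonicalExtension e) {k u : C}
    (hk : IsClosedElt e k) (hu : IsOpenElt e u) (h : diaExt e k ≤ u) :
    ∃ a, k ≤ e a ∧ diaExt e (e a) ≤ u := by
  obtain ⟨a, ha, h'⟩ := (he.sigmaExt_closed_le_iff dia_mono hk hu).1 h
  exact ⟨a, ha, (he.diaExt_map a).trans_le h'⟩

theorem IsCanonicalExtension.exists_le_diaExt (he : IsCanonicalExtension e) {k u : C}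
    (hu : IsOpenElt e u) (hk : IsClosedElt e k) (h : k ≤ diaExt e u) :
    ∃ a, e a ≤ u ∧ k ≤ diaExt e (e a) := by
  obtain ⟨a, ha, h'⟩ := he.le_sigmaExt_open dia_mono hu hk h
  exact ⟨a, ha, h'.trans_eq (he.diaExt_map a).symm⟩

theorem IsCanonicalExtension.exists_le_boxExt (he : IsCanonicalExtension e) {k u : C}
    (hu : IsOpenElt e u) (hk : IsClosedElt e k) (h : k ≤ boxExt e u) :
    ∃ a, e a ≤ u ∧ k ≤ boxExt e (e a) := by
  obtain ⟨a, ha, h'⟩ := (he.le_piExt_open_iff box_mono hu hk).1 h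
  exact ⟨a, ha, h'.trans_eq (he.boxExt_map a).symm⟩

theorem IsCanonicalExtension.exists_boxExt_le (he : IsCanonicalExtension e) {k u : C}
    (hk : IsClosedElt e k) (hu : IsOpenElt e u) (h : boxExt e k ≤ u) :
    ∃ a, k ≤ e a ∧ boxExt e (e a) ≤ u := by
  obtain ⟨a, ha, h'⟩ := he.piExt_closed_le box_mono hk hu h
  exact ⟨a, ha, (he.boxExt_map a).trans_le h'⟩

/-- As a left adjoint the diamond preserves all joins, in particular the join of the irreducibles
below `c`; primality of `j` selects one of them. -/
theorem IsCanonicalExtension.exists_le_diaExt_cji (he : IsCanonicalExtension e) {j c : C}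
    (hj : IsCJI j) (h : j ≤ diaExt e c) : ∃ i, IsCJI i ∧ j ≤ diaExt e i ∧ i ≤ c := by
  rw [he.eq_sSup_cji c, he.gc_dia_bbox.l_sSup, ← sSup_image] at h
  obtain ⟨_, ⟨i, ⟨hi, hic⟩, rfl⟩, hle⟩ := hj.exists_le h
  exact ⟨i, hi, hle, hic⟩

theorem IsCanonicalExtension.exists_boxExt_le_cmi (he : IsCanonicalExtension e) {m c : C}
    (hm : IsCMI m) (h : boxExt e c ≤ m) : ∃ n, IsCMI n ∧ boxExt e n ≤ m ∧ c ≤ n := by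
  rw [he.eq_sInf_cmi c, he.gc_bdia_box.u_sInf, ← sInf_image] at h
  obtain ⟨_, ⟨n, ⟨hn, hcn⟩, rfl⟩, hle⟩ := hm.exists_le h
  exact ⟨n, hn, hle, hcn⟩

end Modalities

/-! ### Syntactic invariants of starring, substitution and finite disjunctions and conjunctions. -/

namespace Form

@[simp] theorem noms_star (φ : Form) : φ.star.noms = φ.noms := by
  induction φ <;> simp_all [star, noms]

@[simp] theorem cnoms_star (φ : Form) : φ.star.cnoms = φ.cnoms := by
  induction φ <;> simp_all [star, cnoms]

@[simp] theorem freeVars_star (φ : Form) : φ.star.freeVars = φ.freeVars := by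
  induction φ <;> simp_all [star, freeVars]

@[simp] theorem propSign_star (p : ℕ) (s : Bool) (φ : Form) :
    PropSign p s φ.star ↔ PropSign p s φ := by
  induction φ generalizing s <;> simp_all [star, PropSign, -Bool.forall_bool]

@[simp] theorem varSign_star (X : ℕ) (s : Bool) (φ : Form) :
    VarSign X s φ.star ↔ VarSign X s φ := by
  induction φ generalizing s <;> simp_all [star, VarSign, -Bool.forall_bool]

theorem star_subst (p : ℕ) (α φ : Form) : (subst p α φ).star = subst p α.star φ.star := by
  induction φ with
  | prop q => by_cases h : q = p <;> simp [subst, star, h]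
  | _ => simp_all [subst, star]

theorem freeVars_subst_subset (p : ℕ) (α φ : Form) :
    (subst p α φ).freeVars ⊆ α.freeVars ∪ φ.freeVars := by
  induction φ with
  | prop q => by_cases h : q = p <;> simp [subst, freeVars, h]
  | _ => simp only [subst, freeVars] at *; grind

theorem noms_subst_subset (p : ℕ) (α φ : Form) :
    (subst p α φ).noms ⊆ α.noms ∪ φ.noms := by
  induction φ with
  | prop q => by_cases h : q = p <;> simp [subst, noms, h]
  | _ => simp only [subst, noms] at *; grind

theorem cnoms_subst_subset (p : ℕ) (α φ : Form) :
    (subst p α φ).cnoms ⊆ α.cnoms ∪ φ.cnoms := by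
  induction φ with
  | prop q => by_cases h : q = p <;> simp [subst, cnoms, h]
  | _ => simp only [subst, cnoms] at *; grind

theorem IsSentence.subst {α φ : Form} (hα : α.IsSentence) (hφ : φ.IsSentence) (p : ℕ) :
    (subst p α φ).IsSentence := by
  have h := freeVars_subst_subset p α φ
  rw [hα, hφ] at h
  exact Finset.subset_empty.1 h

theorem propSign_of_notMem {p : ℕ} {φ : Form} (h : p ∉ φ.props) (s : Bool) : PropSign p s φ := by
  induction φ generalizing s with
  | prop q =>
    intro hq
    simp [props, hq] at h
  | _ => simp_all [props, PropSign, -Bool.forall_bool]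

theorem IsL1.noms_eq {φ : Form} (h : φ.IsL1) : φ.noms = ∅ := by
  induction φ <;> simp_all [IsL1, noms]

theorem IsL1.cnoms_eq {φ : Form} (h : φ.IsL1) : φ.cnoms = ∅ := by
  induction φ <;> simp_all [IsL1, cnoms]

theorem isSentence_bigOr {l : List Form} (h : ∀ α ∈ l, α.IsSentence) : (bigOr l).IsSentence := by
  induction l with
  | nil => rfl
  | cons α l ih =>
    cases l with
    | nil => exact h α (by simp)
    | cons β l =>
      have h₁ := h α (by simp)
      have h₂ := ih fun γ hγ => h γ (by simp [hγ])
      simp only [IsSentence, bigOr, freeVars] at *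
      rw [h₁, h₂, Finset.union_empty]

theorem isSentence_bigAnd {l : List Form} (h : ∀ α ∈ l, α.IsSentence) :
    (bigAnd l).IsSentence := by
  induction l with
  | nil => rfl
  | cons α l ih =>
    cases l with
    | nil => exact h α (by simp)
    | cons β l =>
      have h₁ := h α (by simp)
      have h₂ := ih fun γ hγ => h γ (by simp [hγ])
      simp only [IsSentence, bigAnd, freeVars] at *
      rw [h₁, h₂, Finset.union_empty]

theorem synOC_bigOr {b : Bool} {l : List Form} (h : ∀ α ∈ l, α.SynOC b) : (bigOr l).SynOC b := by
  induction l with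
  | nil => trivial
  | cons α l ih =>
    cases l with
    | nil => exact h α (by simp)
    | cons β l => exact ⟨h α (by simp), ih fun γ hγ => h γ (by simp [hγ])⟩

theorem synOC_bigAnd {b : Bool} {l : List Form} (h : ∀ α ∈ l, α.SynOC b) :
    (bigAnd l).SynOC b := by
  induction l with
  | nil => trivial
  | cons α l ih =>
    cases l with
    | nil => exact h α (by simp)
    | cons β l => exact ⟨h α (by simp), ih fun γ hγ => h γ (by simp [hγ])⟩

end Form

/-! ### Modified assignments. -/

namespace Assignment

variable {C : Type v} [CompleteLattice C]

/-- Change the value of one propositional variable. -/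
def setProp (V : Assignment C) (p : ℕ) (c : C) : Assignment C :=
  { V with prop := Function.update V.prop p c }

/-- Change the value of one nominal. -/
def setNom (V : Assignment C) (j : ℕ) (c : C) (hc : IsCJI c) : Assignment C :=
  { V with
    nom := Function.update V.nom j c
    nom_cji := fun i => by
      by_cases h : i = j
      · subst h; simpa using hc
      · simpa [h] using V.nom_cji i }

/-- Change the value of one co-nominal. -/
def setCnom (V : Assignment C) (m : ℕ) (c : C) (hc : IsCMI c) : Assignment C :=
  { V with
    cnom := Function.update V.cnom m c
    cnom_cmi := fun i => by
      by_cases h : i = m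
      · subst h; simpa using hc
      · simpa [h] using V.cnom_cmi i }

/-- Two assignments differ at most at `p`, where the second one is larger. -/
structure LeAt (p : ℕ) (V W : Assignment C) : Prop where
  prop_eq : ∀ q, q ≠ p → V.prop q = W.prop q
  prop_le : V.prop p ≤ W.prop p
  nom_eq : V.nom = W.nom
  cnom_eq : V.cnom = W.cnom

theorem leAt_setProp (V : Assignment C) (p : ℕ) {c d : C} (h : c ≤ d) :
    LeAt p (V.setProp p c) (V.setProp p d) where
  prop_eq q hq := by simp [setProp, hq]
  prop_le := by simpa [setProp] using h
  nom_eq := rfl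
  cnom_eq := rfl

theorem setProp_self (V : Assignment C) (p : ℕ) : V.setProp p (V.prop p) = V := by
  cases V
  simp [setProp]

end Assignment

/-! ### Evaluation: dependence on the assignment, substitution, monotonicity and agreement with `A`.
-/

section Eval

variable {A : Type u} {C : Type v} [ModalBiHeyting A] [CompletelyDistribLattice C]

theorem eval_congr {e : A → C} {V W : Assignment C} {φ : Form} {ρ σ : ℕ → C}
    (hp : ∀ p ∈ φ.props, V.prop p = W.prop p) (hj : ∀ j ∈ φ.noms, V.nom j = W.nom j)
    (hm : ∀ m ∈ φ.cnoms, V.cnom m = W.cnom m) (hX : ∀ X ∈ φ.freeVars, ρ X = σ X) :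
    eval e V φ ρ = eval e W φ σ := by
  have key : ∀ (X : ℕ) (ψ : Form), (∀ Y ∈ ψ.freeVars.erase X, ρ Y = σ Y) → ∀ c, ∀ Y ∈ ψ.freeVars,
      Function.update ρ X c Y = Function.update σ X c Y := by
    intro X ψ h c Y hY
    by_cases hYX : Y = X
    · subst hYX; simp
    · simpa [hYX] using h Y (by simp [hYX, hY])
  induction φ generalizing ρ σ with
  | bot | top => rfl
  | prop p => exact hp p (by simp [Form.props])
  | fvar X => exact hX X (by simp [Form.freeVars])
  | nom j => exact hj j (by simp [Form.noms])
  | cnom m => exact hm m (by simp [Form.cnoms])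
  | and φ ψ ih₁ ih₂ | or φ ψ ih₁ ih₂ | imp φ ψ ih₁ ih₂ | sub φ ψ ih₁ ih₂ =>
    simp only [Form.props, Form.noms, Form.cnoms, Form.freeVars, Finset.mem_union] at hp hj hm hX
    have h₁ := ih₁ (fun p h => hp p (.inl h)) (fun p h => hj p (.inl h)) (fun p h => hm p (.inl h))
      (ρ := ρ) (σ := σ) (fun p h => hX p (.inl h)) (key := by grind)
    have h₂ := ih₂ (fun p h => hp p (.inr h)) (fun p h => hj p (.inr h)) (fun p h => hm p (.inr h))
      (ρ := ρ) (σ := σ) (fun p h => hX p (.inr h)) (key := by grind)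
    simp only [eval, h₁, h₂]
  | dia φ ih | box φ ih | bbox φ ih | bdia φ ih =>
    simp only [eval, ih hp hj hm hX key]
  | mu X φ ih | nu X φ ih | muS X φ ih | nuS X φ ih =>
    have := fun c => ih hp hj hm (key X φ hX c) (by grind)
    simp only [eval, this]

theorem eval_eq_of_isSentence {e : A → C} {V : Assignment C} {φ : Form} (h : φ.IsSentence)
    (ρ σ : ℕ → C) : eval e V φ ρ = eval e V φ σ :=
  eval_congr (fun _ _ => rfl) (fun _ _ => rfl) (fun _ _ => rfl) (by rw [h]; simp)

theorem eval_setProp_of_notMem {e : A → C} {V : Assignment C} {φ : Form} {p : ℕ}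
    (h : p ∉ φ.props) (c : C) (ρ : ℕ → C) : eval e (V.setProp p c) φ ρ = eval e V φ ρ := by
  refine eval_congr (fun q hq => ?_) (fun _ _ => rfl) (fun _ _ => rfl) (fun _ _ => rfl)
  have : q ≠ p := fun hqp => h (hqp ▸ hq)
  simp [Assignment.setProp, this]

theorem eval_setNom_of_notMem {e : A → C} {V : Assignment C} {φ : Form} {j : ℕ}
    (h : j ∉ φ.noms) {c : C} (hc : IsCJI c) (ρ : ℕ → C) :
    eval e (V.setNom j c hc) φ ρ = eval e V φ ρ := by
  refine eval_congr (fun _ _ => rfl) (fun q hq => ?_) (fun _ _ => rfl) (fun _ _ => rfl)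
  have : q ≠ j := fun hqp => h (hqp ▸ hq)
  simp [Assignment.setNom, this]

theorem eval_setCnom_of_notMem {e : A → C} {V : Assignment C} {φ : Form} {m : ℕ}
    (h : m ∉ φ.cnoms) {c : C} (hc : IsCMI c) (ρ : ℕ → C) :
    eval e (V.setCnom m c hc) φ ρ = eval e V φ ρ := by
  refine eval_congr (fun _ _ => rfl) (fun _ _ => rfl) (fun q hq => ?_) (fun _ _ => rfl)
  have : q ≠ m := fun hqp => h (hqp ▸ hq)
  simp [Assignment.setCnom, this]

/-- Since `α` is a sentence, its value can be computed in a fixed environment `σ` while `ρ` changes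
under binders. -/
theorem eval_subst {e : A → C} {V : Assignment C} {α : Form} (hα : α.IsSentence) (p : ℕ)
    (φ : Form) (σ ρ : ℕ → C) :
    eval e V (Form.subst p α φ) ρ = eval e (V.setProp p (eval e V α σ)) φ ρ := by
  induction φ generalizing ρ with
  | prop q =>
    by_cases h : q = p
    · simpa [Form.subst, h, eval, Assignment.setProp] using eval_eq_of_isSentence hα ρ σ
    · simp [Form.subst, h, eval, Assignment.setProp]
  | _ => simp_all [Form.subst, eval, Assignment.setProp]

theorem eval_bigOr_le_iff {e : A → C} {V : Assignment C} {l : List Form} {ρ : ℕ → C} {c : C} :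
    eval e V (Form.bigOr l) ρ ≤ c ↔ ∀ α ∈ l, eval e V α ρ ≤ c := by
  induction l with
  | nil => simp [Form.bigOr, eval]
  | cons α l ih =>
    cases l with
    | nil => simp [Form.bigOr]
    | cons β l => rw [List.forall_mem_cons, ← ih]; exact sup_le_iff

theorem le_eval_bigAnd_iff {e : A → C} {V : Assignment C} {l : List Form} {ρ : ℕ → C} {c : C} :
    c ≤ eval e V (Form.bigAnd l) ρ ↔ ∀ α ∈ l, c ≤ eval e V α ρ := by
  induction l with
  | nil => simp [Form.bigAnd, eval]
  | cons α l ih =>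
    cases l with
    | nil => simp [Form.bigAnd]
    | cons β l => rw [List.forall_mem_cons, ← ih]; exact le_inf_iff

variable {e : BoundedLatticeHom A C}

theorem IsCanonicalExtension.diaExt_mono (he : IsCanonicalExtension e) : Monotone (diaExt e) :=
  he.gc_dia_bbox.monotone_l

theorem IsCanonicalExtension.boxExt_mono (he : IsCanonicalExtension e) : Monotone (boxExt e) :=
  he.gc_bdia_box.monotone_u

/-- The value of a formula is monotone in the propositional variables in which it is positive, and
antitone in those in which it is negative. -/
theorem IsCanonicalExtension.eval_mono_prop (he : IsCanonicalExtension e) {p : ℕ}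
    {V W : Assignment C} (h : V.LeAt p W) (φ : Form) (ρ : ℕ → C) :
    (φ.PropSign p true → eval e V φ ρ ≤ eval e W φ ρ) ∧
      (φ.PropSign p false → eval e W φ ρ ≤ eval e V φ ρ) := by
  induction φ generalizing ρ with
  | bot | top | fvar => exact ⟨fun _ => le_rfl, fun _ => le_rfl⟩
  | prop q =>
    by_cases hq : q = p
    · subst hq
      exact ⟨fun _ => h.prop_le, fun h' => absurd (h' rfl) (by simp)⟩
    · exact ⟨fun _ => (h.prop_eq q hq).le, fun _ => (h.prop_eq q hq).ge⟩
  | nom j => simp [eval, h.nom_eq]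
  | cnom m => simp [eval, h.cnom_eq]
  | and φ ψ ih₁ ih₂ =>
    exact ⟨fun hs => inf_le_inf ((ih₁ ρ).1 hs.1) ((ih₂ ρ).1 hs.2),
      fun hs => inf_le_inf ((ih₁ ρ).2 hs.1) ((ih₂ ρ).2 hs.2)⟩
  | or φ ψ ih₁ ih₂ =>
    exact ⟨fun hs => sup_le_sup ((ih₁ ρ).1 hs.1) ((ih₂ ρ).1 hs.2),
      fun hs => sup_le_sup ((ih₁ ρ).2 hs.1) ((ih₂ ρ).2 hs.2)⟩
  | imp φ ψ ih₁ ih₂ =>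
    exact ⟨fun hs => himp_le_himp ((ih₁ ρ).2 hs.1) ((ih₂ ρ).1 hs.2),
      fun hs => himp_le_himp ((ih₁ ρ).1 hs.1) ((ih₂ ρ).2 hs.2)⟩
  | sub φ ψ ih₁ ih₂ =>
    exact ⟨fun hs => sdiff_le_sdiff ((ih₁ ρ).1 hs.1) ((ih₂ ρ).2 hs.2),
      fun hs => sdiff_le_sdiff ((ih₁ ρ).2 hs.1) ((ih₂ ρ).1 hs.2)⟩
  | dia φ ih =>
    exact ⟨fun hs => he.diaExt_mono ((ih ρ).1 hs),
      fun hs => he.diaExt_mono ((ih ρ).2 hs)⟩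
  | box φ ih =>
    exact ⟨fun hs => he.boxExt_mono ((ih ρ).1 hs),
      fun hs => he.boxExt_mono ((ih ρ).2 hs)⟩
  | bbox φ ih =>
    exact ⟨fun hs => he.gc_dia_bbox.monotone_u ((ih ρ).1 hs),
      fun hs => he.gc_dia_bbox.monotone_u ((ih ρ).2 hs)⟩
  | bdia φ ih =>
    exact ⟨fun hs => he.gc_bdia_box.monotone_l ((ih ρ).1 hs),
      fun hs => he.gc_bdia_box.monotone_l ((ih ρ).2 hs)⟩
  | mu X φ ih =>
    exact ⟨fun hs => sInf_le_sInf fun c hc => ((ih _).1 hs).trans hc,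
      fun hs => sInf_le_sInf fun c hc => ((ih _).2 hs).trans hc⟩
  | nu X φ ih =>
    exact ⟨fun hs => sSup_le_sSup fun c hc => le_trans hc ((ih _).1 hs),
      fun hs => sSup_le_sSup fun c hc => le_trans hc ((ih _).2 hs)⟩
  | muS X φ ih =>
    exact ⟨fun hs => sInf_le_sInf (Set.image_mono fun c hc => ((ih _).1 hs).trans hc),
      fun hs => sInf_le_sInf (Set.image_mono fun c hc => ((ih _).2 hs).trans hc)⟩
  | nuS X φ ih =>
    exact ⟨fun hs => sSup_le_sSup (Set.image_mono fun c hc => le_trans hc ((ih _).1 hs)),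
      fun hs => sSup_le_sSup (Set.image_mono fun c hc => le_trans hc ((ih _).2 hs))⟩

/-- The value of a formula is monotone in the fixed point variables in which it is positive, and
antitone in those in which it is negative. -/
theorem IsCanonicalExtension.eval_mono_fvar (he : IsCanonicalExtension e) {X : ℕ}
    {V : Assignment C} (φ : Form) {ρ σ : ℕ → C} (hX : ρ X ≤ σ X) (h : ∀ Y, Y ≠ X → ρ Y = σ Y) :
    (φ.VarSign X true → eval e V φ ρ ≤ eval e V φ σ) ∧
      (φ.VarSign X false → eval e V φ σ ≤ eval e V φ ρ) := by
  have key : ∀ {ρ σ : ℕ → C}, ρ X ≤ σ X → (∀ Y, Y ≠ X → ρ Y = σ Y) → ∀ Y c,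
      Function.update ρ Y c X ≤ Function.update σ Y c X ∧
        ∀ Z, Z ≠ X → Function.update ρ Y c Z = Function.update σ Y c Z := by
    intro ρ σ hX h Y c
    simp only [Function.update_apply]
    grind
  have key' : ∀ {ρ σ : ℕ → C}, (∀ Y, Y ≠ X → ρ Y = σ Y) → ∀ c,
      Function.update ρ X c = Function.update σ X c := by
    intro ρ σ h c
    funext Z
    simp only [Function.update_apply]
    grind
  induction φ generalizing ρ σ with
  | bot | top | prop | nom | cnom => exact ⟨fun _ => le_rfl, fun _ => le_rfl⟩
  | fvar Y =>
    by_cases hY : Y = X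
    · subst hY
      exact ⟨fun _ => hX, fun h' => absurd (h' rfl) (by simp)⟩
    · exact ⟨fun _ => (h Y hY).le, fun _ => (h Y hY).ge⟩
  | and φ ψ ih₁ ih₂ =>
    exact ⟨fun hs => inf_le_inf ((ih₁ hX h).1 hs.1) ((ih₂ hX h).1 hs.2),
      fun hs => inf_le_inf ((ih₁ hX h).2 hs.1) ((ih₂ hX h).2 hs.2)⟩
  | or φ ψ ih₁ ih₂ =>
    exact ⟨fun hs => sup_le_sup ((ih₁ hX h).1 hs.1) ((ih₂ hX h).1 hs.2),
      fun hs => sup_le_sup ((ih₁ hX h).2 hs.1) ((ih₂ hX h).2 hs.2)⟩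
  | imp φ ψ ih₁ ih₂ =>
    exact ⟨fun hs => himp_le_himp ((ih₁ hX h).2 hs.1) ((ih₂ hX h).1 hs.2),
      fun hs => himp_le_himp ((ih₁ hX h).1 hs.1) ((ih₂ hX h).2 hs.2)⟩
  | sub φ ψ ih₁ ih₂ =>
    exact ⟨fun hs => sdiff_le_sdiff ((ih₁ hX h).1 hs.1) ((ih₂ hX h).2 hs.2),
      fun hs => sdiff_le_sdiff ((ih₁ hX h).2 hs.1) ((ih₂ hX h).1 hs.2)⟩
  | dia φ ih =>
    exact ⟨fun hs => he.diaExt_mono ((ih hX h).1 hs),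
      fun hs => he.diaExt_mono ((ih hX h).2 hs)⟩
  | box φ ih =>
    exact ⟨fun hs => he.boxExt_mono ((ih hX h).1 hs),
      fun hs => he.boxExt_mono ((ih hX h).2 hs)⟩
  | bbox φ ih =>
    exact ⟨fun hs => he.gc_dia_bbox.monotone_u ((ih hX h).1 hs),
      fun hs => he.gc_dia_bbox.monotone_u ((ih hX h).2 hs)⟩
  | bdia φ ih =>
    exact ⟨fun hs => he.gc_bdia_box.monotone_l ((ih hX h).1 hs),
      fun hs => he.gc_bdia_box.monotone_l ((ih hX h).2 hs)⟩
  | mu Y φ ih | nu Y φ ih | muS Y φ ih | nuS Y φ ih =>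
    -- A binder of `X` overwrites the only coordinate in which the environments differ.
    by_cases hY : Y = X
    · subst hY
      simp only [eval, key' h, le_refl, implies_true, and_self]
    · have ih' := fun c => ih (key hX h Y c).1 (key hX h Y c).2
      simp only [Form.VarSign, hY, false_or]
      -- One alternative for each binder: meet or join, over all of `C` or over the image of `A`.
      first
        | exact ⟨fun hs => sInf_le_sInf fun c hc => ((ih' _).1 hs).trans hc,
            fun hs => sInf_le_sInf fun c hc => ((ih' _).2 hs).trans hc⟩
        | exact ⟨fun hs => sSup_le_sSup fun c hc => le_trans hc ((ih' _).1 hs),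
            fun hs => sSup_le_sSup fun c hc => le_trans hc ((ih' _).2 hs)⟩
        | exact ⟨fun hs => sInf_le_sInf (Set.image_mono fun c hc => ((ih' _).1 hs).trans hc),
            fun hs => sInf_le_sInf (Set.image_mono fun c hc => ((ih' _).2 hs).trans hc)⟩
        | exact ⟨fun hs => sSup_le_sSup (Set.image_mono fun c hc => le_trans hc ((ih' _).1 hs)),
            fun hs => sSup_le_sSup (Set.image_mono fun c hc => le_trans hc ((ih' _).2 hs))⟩

/-- In a mu-algebra of the first kind, the value of a formula agrees with the value of its starred
version in the canonical extension. -/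
theorem IsCanonicalExtension.eval_star_of_denotes (he : IsCanonicalExtension e)
    (hA : IsFirstKind A) {V : Assignment C} {v : ℕ → A} (hV : ∀ p, V.prop p = e (v p))
    {φ : Form} (hφ : φ.IsL1) {ρ : ℕ → A} {a : A} (h : Denotes v φ ρ a) :
    eval e V φ.star (fun X => e (ρ X)) = e a := by
  have upd : ∀ (ρ : ℕ → A) (X : ℕ) (b : A), Function.update (fun Y => e (ρ Y)) X (e b) =
      fun Y => e (Function.update ρ X b Y) := by
    intro ρ X b
    funext Y
    by_cases hY : Y = X
    · subst hY; simp
    · simp [hY]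
  induction φ generalizing ρ a with
  | bot | top => cases h; simp [Form.star, eval]
  | prop p => cases h; simp [Form.star, eval, hV]
  | fvar X => cases h; simp [Form.star, eval]
  | nom | cnom | bbox | bdia | muS | nuS => exact hφ.elim
  | and φ ψ ih₁ ih₂ | or φ ψ ih₁ ih₂ =>
    obtain ⟨b, c, hb, hc, rfl⟩ := h
    simp [Form.star, eval, ih₁ hφ.1 hb, ih₂ hφ.2 hc]
  | imp φ ψ ih₁ ih₂ =>
    obtain ⟨b, c, hb, hc, rfl⟩ := h
    simp only [Form.star, eval, ih₁ hφ.1 hb, ih₂ hφ.2 hc, he.map_himp]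
  | sub φ ψ ih₁ ih₂ =>
    obtain ⟨b, c, hb, hc, rfl⟩ := h
    simp only [Form.star, eval, ih₁ hφ.1 hb, ih₂ hφ.2 hc, he.map_sdiff]
  | dia φ ih =>
    obtain ⟨b, hb, rfl⟩ := h
    simp only [Form.star, eval, ih hφ hb, he.diaExt_map]
  | box φ ih =>
    obtain ⟨b, hb, rfl⟩ := h
    simp only [Form.star, eval, ih hφ hb, he.boxExt_map]
  | mu X φ ih =>
    have hmem : ∀ b c, Denotes v φ (Function.update ρ X b) c →
        eval e V φ.star (Function.update (fun Y => e (ρ Y)) X (e b)) = e c := fun b c hc => by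
      rw [upd]
      exact ih hφ.1 hc
    have hex := fun b => hA φ hφ.1 v (Function.update ρ X b)
    obtain ⟨c, hc⟩ := hex a
    -- The Knaster–Tarski argument: by monotonicity the body at `a` is below every pre-fixed point,
    -- so `a` is pre-fixed. Being of the first kind guarantees that the body has a value at `a` at
    -- all.
    have hca : c ≤ a := by
      refine (le_isGLB_iff h).2 ?_
      rintro b ⟨d, hd, hdb⟩
      refine le_trans (he.map_le_map_iff.1 ?_) hdb
      rw [← hmem a c hc, ← hmem b d hd]
      refine (he.eval_mono_fvar _ ?_ ?_).1 ((Form.varSign_star _ _ _).2 hφ.2)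
      · simpa using he.map_le_map_iff.2 (h.1 ⟨d, hd, hdb⟩)
      · intro Y hY
        simp [hY]
    -- The starred meet is attained at `e a`.
    refine le_antisymm (sInf_le ⟨a, (hmem a c hc).trans_le (he.map_le_map_iff.2 hca), rfl⟩)
      (le_sInf ?_)
    rintro _ ⟨b, hb, rfl⟩
    obtain ⟨d, hd⟩ := hex b
    refine he.map_le_map_iff.2 (h.1 ⟨d, hd, he.map_le_map_iff.1 ?_⟩)
    rw [← hmem b d hd]
    exact hb
  | nu X φ ih =>
    have hmem : ∀ b c, Denotes v φ (Function.update ρ X b) c →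
        eval e V φ.star (Function.update (fun Y => e (ρ Y)) X (e b)) = e c := fun b c hc => by
      rw [upd]
      exact ih hφ.1 hc
    have hex := fun b => hA φ hφ.1 v (Function.update ρ X b)
    obtain ⟨c, hc⟩ := hex a
    have hca : a ≤ c := by
      refine (isLUB_le_iff h).2 ?_
      rintro b ⟨d, hd, hdb⟩
      refine le_trans hdb (he.map_le_map_iff.1 ?_)
      rw [← hmem a c hc, ← hmem b d hd]
      refine (he.eval_mono_fvar _ ?_ ?_).1 ((Form.varSign_star _ _ _).2 hφ.2)
      · simpa using he.map_le_map_iff.2 (h.1 ⟨d, hd, hdb⟩)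
      · intro Y hY
        simp [hY]
    refine le_antisymm (sSup_le ?_)
      (le_sSup ⟨a, (he.map_le_map_iff.2 hca).trans_eq (hmem a c hc).symm, rfl⟩)
    rintro _ ⟨b, hb, rfl⟩
    obtain ⟨d, hd⟩ := hex b
    refine he.map_le_map_iff.2 (h.1 ⟨d, hd, he.map_le_map_iff.1 ?_⟩)
    rw [← hmem b d hd]
    exact hb

end Eval

/-! ### Approximating closed and open values of one variable by elements of the algebra. -/

section Approximation

variable {A : Type u} {C : Type v} [ModalBiHeyting A] [CompletelyDistribLattice C]
  {e : BoundedLatticeHom A C} {p : ℕ} {t : Bool} {V : Assignment C} {D : Set (Assignment C)}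

/-- Two assignments differ at most at `p`, where the first one is smaller (for `true`) or larger
(for `false`). -/
def Assignment.Finer (p : ℕ) : Bool → Assignment C → Assignment C → Prop
  | true, V, W => V.LeAt p W
  | false, V, W => W.LeAt p V

/-- The family `D` of assignments approximates the assignment `V`, which takes values in the algebra
except possibly at `p`: from above if the value at `p` is closed (`t = true`), from below if it is
open (`t = false`). -/
structure ApproxFamily (e : BoundedLatticeHom A C) (p : ℕ) (t : Bool) (V : Assignment C)
    (D : Set (Assignment C)) : Prop where
  nonempty : D.Nonempty
  directed : ∀ W₁ ∈ D, ∀ W₂ ∈ D, ∃ W ∈ D, W.Finer p t W₁ ∧ W.Finer p t W₂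
  prop_eq : ∀ W ∈ D, ∀ q, q ≠ p → W.prop q = V.prop q
  nom_eq : ∀ W ∈ D, W.nom = V.nom
  cnom_eq : ∀ W ∈ D, W.cnom = V.cnom
  mem_range : ∀ q, q ≠ p → ∃ a, V.prop q = e a
  closed : t = true → IsClosedElt e (V.prop p) ∧ ∀ b, V.prop p ≤ e b → ∃ W ∈ D, W.prop p ≤ e b
  isOpen : t = false → IsOpenElt e (V.prop p) ∧ ∀ b, e b ≤ V.prop p → ∃ W ∈ D, e b ≤ W.prop p

theorem IsCanonicalExtension.eval_le_of_finer (he : IsCanonicalExtension e) {W : Assignment C}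
    (h : V.Finer p t W) {φ : Form} (hφ : φ.PropSign p t) (ρ : ℕ → C) :
    eval e V φ ρ ≤ eval e W φ ρ := by
  cases t
  · exact (he.eval_mono_prop h φ ρ).2 hφ
  · exact (he.eval_mono_prop h φ ρ).1 hφ

theorem IsCanonicalExtension.eval_ge_of_finer (he : IsCanonicalExtension e) {W : Assignment C}
    (h : V.Finer p t W) {φ : Form} (hφ : φ.PropSign p (!t)) (ρ : ℕ → C) :
    eval e W φ ρ ≤ eval e V φ ρ := by
  cases t
  · exact (he.eval_mono_prop h φ ρ).1 hφ
  · exact (he.eval_mono_prop h φ ρ).2 hφ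

/-- Directedness merges finitely many approximants into one. Finiteness comes from the antecedent of
a quasi-inequality or, for the starred binders, from compactness. -/
theorem ApproxFamily.exists_forall_mem (hD : ApproxFamily e p t V D) {ι : Type*}
    {Q : ι → Assignment C → Prop} (s : Multiset ι)
    (hQ : ∀ i ∈ s, ∀ W W' : Assignment C, W'.Finer p t W → Q i W → Q i W')
    (h : ∀ i ∈ s, ∃ W ∈ D, Q i W) : ∃ W ∈ D, ∀ i ∈ s, Q i W := by
  induction s using Multiset.induction_on with
  | empty =>
    obtain ⟨W, hW⟩ := hD.nonempty
    exact ⟨W, hW, by simp⟩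
  | cons i s ih =>
    rw [Multiset.forall_mem_cons] at h hQ
    obtain ⟨W₁, hW₁, h₁⟩ := h.1
    obtain ⟨W₂, hW₂, h₂⟩ := ih hQ.2 h.2
    obtain ⟨W, hW, hf₁, hf₂⟩ := hD.directed W₁ hW₁ W₂ hW₂
    exact ⟨W, hW, Multiset.forall_mem_cons.2
      ⟨hQ.1 _ _ hf₁ h₁, fun i hi => hQ.2 i hi _ _ hf₂ (h₂ i hi)⟩⟩

/-- Syntactically closed formulas take closed values and preserve the approximation, and dually for
syntactically open formulas. -/
theorem ApproxFamily.eval (he : IsCanonicalExtension e) (hD : ApproxFamily e p t V D) (φ : Form)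
    {ρ : ℕ → C} (hρ : ∀ X, ∃ a, ρ X = e a) :
    (φ.SynOC false → φ.PropSign p t → IsClosedElt e (eval e V φ ρ) ∧
      ∀ b, eval e V φ ρ ≤ e b → ∃ W ∈ D, eval e W φ ρ ≤ e b) ∧
    (φ.SynOC true → φ.PropSign p (!t) → IsOpenElt e (eval e V φ ρ) ∧
      ∀ b, e b ≤ eval e V φ ρ → ∃ W ∈ D, e b ≤ eval e W φ ρ) := by
  obtain ⟨W₀, hW₀⟩ := hD.nonempty
  have upd : ∀ {ρ : ℕ → C}, (∀ X, ∃ a, ρ X = e a) → ∀ Y a,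
      ∀ X, ∃ a', Function.update ρ Y (e a) X = e a' := by
    intro ρ hρ Y a X
    by_cases hX : X = Y
    · exact ⟨a, by simp [hX]⟩
    · simpa [hX] using hρ X
  induction φ generalizing ρ with
  | bot =>
    refine ⟨fun _ _ => ⟨⟨{⊥}, by simp [MuALBA.eval]⟩, fun b hb => ⟨W₀, hW₀, hb⟩⟩,
      fun _ _ => ⟨⟨{⊥}, by simp [MuALBA.eval]⟩, fun b hb => ⟨W₀, hW₀, hb⟩⟩⟩
  | top =>
    refine ⟨fun _ _ => ⟨⟨{⊤}, by simp [MuALBA.eval]⟩, fun b hb => ⟨W₀, hW₀, hb⟩⟩,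
      fun _ _ => ⟨⟨{⊤}, by simp [MuALBA.eval]⟩, fun b hb => ⟨W₀, hW₀, hb⟩⟩⟩
  | prop q =>
    by_cases hq : q = p
    · subst hq
      refine ⟨fun _ h => hD.closed (h rfl), fun _ h => hD.isOpen ?_⟩
      simpa using h rfl
    · obtain ⟨a, ha⟩ := hD.mem_range q hq
      have hW := hD.prop_eq W₀ hW₀ q hq
      simp only [MuALBA.eval]
      exact ⟨fun _ _ => ⟨ha ▸ isClosedElt_map a, fun b hb => ⟨W₀, hW₀, hW.trans_le hb⟩⟩,
        fun _ _ => ⟨ha ▸ isOpenElt_map a, fun b hb => ⟨W₀, hW₀, hb.trans_eq hW.symm⟩⟩⟩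
  | fvar X =>
    obtain ⟨a, ha⟩ := hρ X
    simp only [MuALBA.eval]
    exact ⟨fun _ _ => ⟨ha ▸ isClosedElt_map a, fun b hb => ⟨W₀, hW₀, hb⟩⟩,
      fun _ _ => ⟨ha ▸ isOpenElt_map a, fun b hb => ⟨W₀, hW₀, hb⟩⟩⟩
  | nom j =>
    refine ⟨fun _ _ => ⟨he.isClosedElt_of_isCJI (V.nom_cji j), fun b hb => ⟨W₀, hW₀, ?_⟩⟩,
      fun h _ => absurd h (by simp [Form.SynOC])⟩
    simpa only [MuALBA.eval, hD.nom_eq W₀ hW₀] using hb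
  | cnom m =>
    refine ⟨fun h _ => absurd h (by simp [Form.SynOC]),
      fun _ _ => ⟨he.isOpenElt_of_isCMI (V.cnom_cmi m), fun b hb => ⟨W₀, hW₀, ?_⟩⟩⟩
    simpa only [MuALBA.eval, hD.cnom_eq W₀ hW₀] using hb
  | and φ ψ ih₁ ih₂ =>
    constructor
    · rintro ⟨hc₁, hc₂⟩ ⟨hs₁, hs₂⟩
      obtain ⟨k₁, h₁⟩ := (ih₁ hρ).1 hc₁ hs₁
      obtain ⟨k₂, h₂⟩ := (ih₂ hρ).1 hc₂ hs₂
      refine ⟨he.isClosedElt_inf k₁ k₂, fun b hb => ?_⟩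
      obtain ⟨a₁, a₂, ha₁, ha₂, ha⟩ := he.exists_inf_le k₁ k₂ (isOpenElt_map b) hb
      obtain ⟨W₁, hW₁, hle₁⟩ := h₁ a₁ ha₁
      obtain ⟨W₂, hW₂, hle₂⟩ := h₂ a₂ ha₂
      -- The pattern of all binary cases: split at elements of `A`, approximate each argument
      -- separately, then pass to a common refinement, which by the sign conditions keeps both
      -- bounds.
      obtain ⟨W, hW, hf₁, hf₂⟩ := hD.directed W₁ hW₁ W₂ hW₂
      exact ⟨W, hW, (inf_le_inf ((he.eval_le_of_finer hf₁ hs₁ ρ).trans hle₁)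
        ((he.eval_le_of_finer hf₂ hs₂ ρ).trans hle₂)).trans ((map_inf e a₁ a₂).ge.trans ha)⟩
    · rintro ⟨hc₁, hc₂⟩ ⟨hs₁, hs₂⟩
      obtain ⟨k₁, h₁⟩ := (ih₁ hρ).2 hc₁ hs₁
      obtain ⟨k₂, h₂⟩ := (ih₂ hρ).2 hc₂ hs₂
      refine ⟨he.isOpenElt_inf k₁ k₂, fun b hb => ?_⟩
      obtain ⟨W₁, hW₁, hle₁⟩ := h₁ b (hb.trans inf_le_left)
      obtain ⟨W₂, hW₂, hle₂⟩ := h₂ b (hb.trans inf_le_right)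
      obtain ⟨W, hW, hf₁, hf₂⟩ := hD.directed W₁ hW₁ W₂ hW₂
      exact ⟨W, hW, le_inf (hle₁.trans (he.eval_ge_of_finer hf₁ hs₁ ρ))
        (hle₂.trans (he.eval_ge_of_finer hf₂ hs₂ ρ))⟩
  | or φ ψ ih₁ ih₂ =>
    constructor
    · rintro ⟨hc₁, hc₂⟩ ⟨hs₁, hs₂⟩
      obtain ⟨k₁, h₁⟩ := (ih₁ hρ).1 hc₁ hs₁
      obtain ⟨k₂, h₂⟩ := (ih₂ hρ).1 hc₂ hs₂
      refine ⟨he.isClosedElt_sup k₁ k₂, fun b hb => ?_⟩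
      obtain ⟨W₁, hW₁, hle₁⟩ := h₁ b (le_sup_left.trans hb)
      obtain ⟨W₂, hW₂, hle₂⟩ := h₂ b (le_sup_right.trans hb)
      obtain ⟨W, hW, hf₁, hf₂⟩ := hD.directed W₁ hW₁ W₂ hW₂
      exact ⟨W, hW, sup_le ((he.eval_le_of_finer hf₁ hs₁ ρ).trans hle₁)
        ((he.eval_le_of_finer hf₂ hs₂ ρ).trans hle₂)⟩
    · rintro ⟨hc₁, hc₂⟩ ⟨hs₁, hs₂⟩
      obtain ⟨k₁, h₁⟩ := (ih₁ hρ).2 hc₁ hs₁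
      obtain ⟨k₂, h₂⟩ := (ih₂ hρ).2 hc₂ hs₂
      refine ⟨he.isOpenElt_sup k₁ k₂, fun b hb => ?_⟩
      obtain ⟨a₁, a₂, ha₁, ha₂, ha⟩ := he.exists_le_sup k₁ k₂ (isClosedElt_map b) hb
      obtain ⟨W₁, hW₁, hle₁⟩ := h₁ a₁ ha₁
      obtain ⟨W₂, hW₂, hle₂⟩ := h₂ a₂ ha₂
      obtain ⟨W, hW, hf₁, hf₂⟩ := hD.directed W₁ hW₁ W₂ hW₂
      exact ⟨W, hW, (ha.trans_eq (map_sup e a₁ a₂)).trans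
        (sup_le_sup (hle₁.trans (he.eval_ge_of_finer hf₁ hs₁ ρ))
          (hle₂.trans (he.eval_ge_of_finer hf₂ hs₂ ρ)))⟩
  | imp φ ψ ih₁ ih₂ =>
    constructor
    · rintro ⟨hc₁, hc₂⟩ ⟨hs₁, hs₂⟩
      obtain ⟨k₁, h₁⟩ := (ih₁ hρ).2 hc₁ hs₁
      obtain ⟨k₂, h₂⟩ := (ih₂ hρ).1 hc₂ hs₂
      refine ⟨he.isClosedElt_himp k₁ k₂, fun b hb => ?_⟩
      obtain ⟨a₁, a₂, ha₁, ha₂, ha⟩ := he.exists_himp_le k₁ k₂ (isOpenElt_map b) hb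
      obtain ⟨W₁, hW₁, hle₁⟩ := h₁ a₁ ha₁
      obtain ⟨W₂, hW₂, hle₂⟩ := h₂ a₂ ha₂
      obtain ⟨W, hW, hf₁, hf₂⟩ := hD.directed W₁ hW₁ W₂ hW₂
      exact ⟨W, hW, (himp_le_himp (hle₁.trans (he.eval_ge_of_finer hf₁ hs₁ ρ))
        ((he.eval_le_of_finer hf₂ hs₂ ρ).trans hle₂)).trans ha⟩
    · rintro ⟨hc₁, hc₂⟩ ⟨hs₁, hs₂⟩
      rw [Bool.not_not] at hs₁
      obtain ⟨k₁, h₁⟩ := (ih₁ hρ).1 hc₁ hs₁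
      obtain ⟨k₂, h₂⟩ := (ih₂ hρ).2 hc₂ hs₂
      refine ⟨he.isOpenElt_himp k₁ k₂, fun b hb => ?_⟩
      obtain ⟨a₁, a₂, ha₁, ha₂, ha⟩ := he.exists_le_himp k₁ k₂ (isClosedElt_map b) hb
      obtain ⟨W₁, hW₁, hle₁⟩ := h₁ a₁ ha₁
      obtain ⟨W₂, hW₂, hle₂⟩ := h₂ a₂ ha₂
      obtain ⟨W, hW, hf₁, hf₂⟩ := hD.directed W₁ hW₁ W₂ hW₂
      exact ⟨W, hW, ha.trans (himp_le_himp ((he.eval_le_of_finer hf₁ hs₁ ρ).trans hle₁)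
        (hle₂.trans (he.eval_ge_of_finer hf₂ hs₂ ρ)))⟩
  | sub φ ψ ih₁ ih₂ =>
    constructor
    · rintro ⟨hc₁, hc₂⟩ ⟨hs₁, hs₂⟩
      obtain ⟨k₁, h₁⟩ := (ih₁ hρ).1 hc₁ hs₁
      obtain ⟨k₂, h₂⟩ := (ih₂ hρ).2 hc₂ hs₂
      refine ⟨he.isClosedElt_sdiff k₁ k₂, fun b hb => ?_⟩
      obtain ⟨a₁, a₂, ha₁, ha₂, ha⟩ := he.exists_sdiff_le k₁ k₂ (isOpenElt_map b) hb
      obtain ⟨W₁, hW₁, hle₁⟩ := h₁ a₁ ha₁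
      obtain ⟨W₂, hW₂, hle₂⟩ := h₂ a₂ ha₂
      obtain ⟨W, hW, hf₁, hf₂⟩ := hD.directed W₁ hW₁ W₂ hW₂
      exact ⟨W, hW, (sdiff_le_sdiff ((he.eval_le_of_finer hf₁ hs₁ ρ).trans hle₁)
        (hle₂.trans (he.eval_ge_of_finer hf₂ hs₂ ρ))).trans ha⟩
    · rintro ⟨hc₁, hc₂⟩ ⟨hs₁, hs₂⟩
      rw [Bool.not_not] at hs₂
      obtain ⟨k₁, h₁⟩ := (ih₁ hρ).2 hc₁ hs₁
      obtain ⟨k₂, h₂⟩ := (ih₂ hρ).1 hc₂ hs₂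
      refine ⟨he.isOpenElt_sdiff k₁ k₂, fun b hb => ?_⟩
      obtain ⟨a₁, a₂, ha₁, ha₂, ha⟩ := he.exists_le_sdiff k₁ k₂ (isClosedElt_map b) hb
      obtain ⟨W₁, hW₁, hle₁⟩ := h₁ a₁ ha₁
      obtain ⟨W₂, hW₂, hle₂⟩ := h₂ a₂ ha₂
      obtain ⟨W, hW, hf₁, hf₂⟩ := hD.directed W₁ hW₁ W₂ hW₂
      exact ⟨W, hW, ha.trans (sdiff_le_sdiff (hle₁.trans (he.eval_ge_of_finer hf₁ hs₁ ρ))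
        ((he.eval_le_of_finer hf₂ hs₂ ρ).trans hle₂))⟩
  | dia φ ih =>
    constructor
    · intro hc hs
      obtain ⟨k, h⟩ := (ih hρ).1 hc hs
      refine ⟨he.isClosedElt_diaExt k, fun b hb => ?_⟩
      obtain ⟨a, ha, hab⟩ := he.exists_diaExt_le k (isOpenElt_map b) hb
      obtain ⟨W, hW, hle⟩ := h a ha
      exact ⟨W, hW, (he.diaExt_mono hle).trans hab⟩
    · intro hc hs
      obtain ⟨k, h⟩ := (ih hρ).2 hc hs
      refine ⟨he.isOpenElt_diaExt k, fun b hb => ?_⟩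
      obtain ⟨a, ha, hab⟩ := he.exists_le_diaExt k (isClosedElt_map b) hb
      obtain ⟨W, hW, hle⟩ := h a ha
      exact ⟨W, hW, hab.trans (he.diaExt_mono hle)⟩
  | box φ ih =>
    constructor
    · intro hc hs
      obtain ⟨k, h⟩ := (ih hρ).1 hc hs
      refine ⟨he.isClosedElt_boxExt k, fun b hb => ?_⟩
      obtain ⟨a, ha, hab⟩ := he.exists_boxExt_le k (isOpenElt_map b) hb
      obtain ⟨W, hW, hle⟩ := h a ha
      exact ⟨W, hW, (he.boxExt_mono hle).trans hab⟩
    · intro hc hs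
      obtain ⟨k, h⟩ := (ih hρ).2 hc hs
      refine ⟨he.isOpenElt_boxExt k, fun b hb => ?_⟩
      obtain ⟨a, ha, hab⟩ := he.exists_le_boxExt k (isClosedElt_map b) hb
      obtain ⟨W, hW, hle⟩ := h a ha
      exact ⟨W, hW, hab.trans (he.boxExt_mono hle)⟩
  | bbox φ ih =>
    refine ⟨fun hc => absurd hc.1 (by simp), fun hc hs => ?_⟩
    obtain ⟨k, h⟩ := (ih hρ).2 hc.2 hs
    refine ⟨he.isOpenElt_bboxExt k, fun b hb => ?_⟩
    -- Adjunction moves the black box to a diamond on the left, where it acts on an element of `A`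
    -- and stays in `A`.
    obtain ⟨W, hW, hle⟩ := h _ ((he.diaExt_map b).ge.trans ((he.gc_dia_bbox _ _).2 hb))
    exact ⟨W, hW, (he.gc_dia_bbox _ _).1 ((he.diaExt_map b).trans_le hle)⟩
  | bdia φ ih =>
    refine ⟨fun hc hs => ?_, fun hc => absurd hc.1 (by simp)⟩
    obtain ⟨k, h⟩ := (ih hρ).1 hc.2 hs
    refine ⟨he.isClosedElt_bdiaExt k, fun b hb => ?_⟩
    obtain ⟨W, hW, hle⟩ := h _ (((he.gc_bdia_box _ _).1 hb).trans_eq (he.boxExt_map b))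
    exact ⟨W, hW, (he.gc_bdia_box _ _).2 (hle.trans_eq (he.boxExt_map b).symm)⟩
  | mu | nu => exact ⟨fun h => h.elim, fun h => h.elim⟩
  | muS X φ ih =>
    refine ⟨fun hc hs => ⟨⟨_, rfl⟩, fun b hb => ?_⟩, fun hc => absurd hc.1 (by simp)⟩
    -- Finitely many pre-fixed points `c` from `A` already have their meet below `e b`. For each of
    -- them the induction hypothesis, with the bound variable set to `e c`, yields an approximant at
    -- which `c` is still pre-fixed.
    obtain ⟨S, T, hS, hT, hST⟩ := he.compact _ {b} (hb.trans (by simp))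
    obtain ⟨W, hW, h⟩ := hD.exists_forall_mem S.val
      (Q := fun c W => MuALBA.eval e W φ (Function.update ρ X (e c)) ≤ e c)
      (fun c _ W W' hf hle => (he.eval_le_of_finer (φ := φ) hf hs _).trans hle)
      (fun c hcS => ((ih (upd hρ X c)).1 hc.2 hs).2 c (hS hcS))
    refine ⟨W, hW, le_trans (Finset.le_inf fun c hcS => ?_)
      (hST.trans (Finset.sup_le fun c hcT => (congrArg e (hT hcT)).le))⟩
    exact sInf_le ⟨c, h c hcS, rfl⟩
  | nuS X φ ih =>
    refine ⟨fun hc => absurd hc.1 (by simp), fun hc hs => ⟨⟨_, rfl⟩, fun b hb => ?_⟩⟩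
    obtain ⟨T, S, hT, hS, hST⟩ := he.compact {b} _ (le_trans (by simp) hb)
    obtain ⟨W, hW, h⟩ := hD.exists_forall_mem S.val
      (Q := fun c W => e c ≤ MuALBA.eval e W φ (Function.update ρ X (e c)))
      (fun c _ W W' hf hle => hle.trans (he.eval_ge_of_finer (φ := φ) hf hs _))
      (fun c hcS => ((ih (upd hρ X c)).2 hc.2 hs).2 c (hS hcS))
    refine ⟨W, hW, le_trans ((Finset.le_inf fun c hcT => (congrArg e (hT hcT)).ge).trans hST)
      (Finset.sup_le fun c hcS => ?_)⟩
    exact le_sSup ⟨c, h c hcS, rfl⟩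

/-- Inequalities between syntactically closed and syntactically open formulas that hold at the
limit already hold at an approximant. -/
theorem ApproxFamily.exists_forall_ineq (he : IsCanonicalExtension e)
    (hD : ApproxFamily e p t V D) {B : Multiset Ineq}
    (hB : ∀ I ∈ B, I.lhs.PropSign p t ∧ I.lhs.SynClosed ∧ I.rhs.PropSign p (!t) ∧ I.rhs.SynOpen)
    {ρ : ℕ → C} (hρ : ∀ X, ∃ a, ρ X = e a)
    (h : ∀ I ∈ B, MuALBA.eval e V I.lhs ρ ≤ MuALBA.eval e V I.rhs ρ) :
    ∃ W ∈ D, ∀ I ∈ B, MuALBA.eval e W I.lhs ρ ≤ MuALBA.eval e W I.rhs ρ := by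
  refine hD.exists_forall_mem B (fun I hI W W' hf hle => ?_) fun I hI => ?_
  · exact (he.eval_le_of_finer hf (hB I hI).1 ρ).trans
      (hle.trans (he.eval_ge_of_finer hf (hB I hI).2.2.1 ρ))
  · obtain ⟨hs₁, hc₁, hs₂, hc₂⟩ := hB I hI
    obtain ⟨k, h₁⟩ := (hD.eval he I.lhs hρ).1 hc₁ hs₁
    obtain ⟨u, h₂⟩ := (hD.eval he I.rhs hρ).2 hc₂ hs₂
    -- An interpolant in `A` decouples the closed left side from the open right side, so each can be
    -- approximated on its own.
    obtain ⟨b, hb₁, hb₂⟩ := he.exists_between k u (h I hI)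
    obtain ⟨W₁, hW₁, hle₁⟩ := h₁ b hb₁
    obtain ⟨W₂, hW₂, hle₂⟩ := h₂ b hb₂
    obtain ⟨W, hW, hf₁, hf₂⟩ := hD.directed W₁ hW₁ W₂ hW₂
    exact ⟨W, hW, ((he.eval_le_of_finer hf₁ hs₁ ρ).trans hle₁).trans
      (hle₂.trans (he.eval_ge_of_finer hf₂ hs₂ ρ))⟩

theorem ApproxFamily.of_closed (hV : ∀ q, ∃ a, V.prop q = e a) (p : ℕ) {k : C}
    (hk : IsClosedElt e k) :
    ApproxFamily e p true (V.setProp p k) {W | ∃ a, k ≤ e a ∧ W = V.setProp p (e a)} where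
  nonempty := ⟨_, ⊤, by simp, rfl⟩
  directed := by
    rintro _ ⟨a, ha, rfl⟩ _ ⟨b, hb, rfl⟩
    refine ⟨_, ⟨a ⊓ b, by rw [map_inf]; exact le_inf ha hb, rfl⟩, ?_, ?_⟩
    · exact V.leAt_setProp p (by rw [map_inf]; exact inf_le_left)
    · exact V.leAt_setProp p (by rw [map_inf]; exact inf_le_right)
  prop_eq := by
    rintro _ ⟨a, -, rfl⟩ q hq
    simp [Assignment.setProp, hq]
  nom_eq := by rintro _ ⟨a, -, rfl⟩; rfl
  cnom_eq := by rintro _ ⟨a, -, rfl⟩; rfl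
  mem_range q hq := by simpa [Assignment.setProp, hq] using hV q
  closed _ := by
    simp only [Assignment.setProp, Function.update_self]
    exact ⟨hk, fun b hb => ⟨_, ⟨b, hb, rfl⟩, by simp⟩⟩
  isOpen h := by simp at h

theorem ApproxFamily.of_isOpen (hV : ∀ q, ∃ a, V.prop q = e a) (p : ℕ) {u : C}
    (hu : IsOpenElt e u) :
    ApproxFamily e p false (V.setProp p u) {W | ∃ a, e a ≤ u ∧ W = V.setProp p (e a)} where
  nonempty := ⟨_, ⊥, by simp, rfl⟩
  directed := by
    rintro _ ⟨a, ha, rfl⟩ _ ⟨b, hb, rfl⟩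
    refine ⟨_, ⟨a ⊔ b, by rw [map_sup]; exact sup_le ha hb, rfl⟩, ?_, ?_⟩
    · exact V.leAt_setProp p (by rw [map_sup]; exact le_sup_left)
    · exact V.leAt_setProp p (by rw [map_sup]; exact le_sup_right)
  prop_eq := by
    rintro _ ⟨a, -, rfl⟩ q hq
    simp [Assignment.setProp, hq]
  nom_eq := by rintro _ ⟨a, -, rfl⟩; rfl
  cnom_eq := by rintro _ ⟨a, -, rfl⟩; rfl
  mem_range q hq := by simpa [Assignment.setProp, hq] using hV q
  closed h := by simp at h
  isOpen _ := by
    simp only [Assignment.setProp, Function.update_self]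
    exact ⟨hu, fun b hb => ⟨_, ⟨b, hb, rfl⟩, by simp⟩⟩

/-- Approximation at a variable that does not occur in `φ`: the sign condition is vacuous and
resetting that variable changes nothing. -/
theorem IsCanonicalExtension.isClosedElt_eval (he : IsCanonicalExtension e)
    (hV : ∀ q, ∃ a, V.prop q = e a) {φ : Form} (hφ : φ.SynClosed) {ρ : ℕ → C}
    (hρ : ∀ X, ∃ a, ρ X = e a) : IsClosedElt e (eval e V φ ρ) := by
  obtain ⟨p, hp⟩ := φ.props.exists_notMem
  have := (((ApproxFamily.of_closed hV p (isClosedElt_map ⊥)).eval he φ hρ).1 hφ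
    (Form.propSign_of_notMem hp _)).1
  rwa [eval_setProp_of_notMem hp] at this

theorem IsCanonicalExtension.isOpenElt_eval (he : IsCanonicalExtension e)
    (hV : ∀ q, ∃ a, V.prop q = e a) {φ : Form} (hφ : φ.SynOpen) {ρ : ℕ → C}
    (hρ : ∀ X, ∃ a, ρ X = e a) : IsOpenElt e (eval e V φ ρ) := by
  obtain ⟨p, hp⟩ := φ.props.exists_notMem
  have := (((ApproxFamily.of_closed hV p (isClosedElt_map ⊥)).eval he φ hρ).2 hφ
    (Form.propSign_of_notMem hp _)).1
  rwa [eval_setProp_of_notMem hp] at this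

end Approximation

/-! ### Admissible assignments. -/

section Admissible

variable {A : Type u} {C : Type v} [CompletelyDistribLattice C]

/-- An assignment is admissible if it sends propositional variables to elements of the algebra. -/
def Assignment.IsAdmissible (e : A → C) (V : Assignment C) : Prop := ∀ p, ∃ a, V.prop p = e a

theorem Assignment.IsAdmissible.setProp {e : A → C} {V : Assignment C} (hV : V.IsAdmissible e)
    (p : ℕ) (a : A) : (V.setProp p (e a)).IsAdmissible e := fun q => by
  by_cases hq : q = p
  · exact ⟨a, by simp [Assignment.setProp, hq]⟩
  · simpa [Assignment.setProp, hq] using hV q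

end Admissible

/-! ### Soundness of tame runs. -/

section Runs

variable {A : Type u} {C : Type v} [ModalBiHeyting A] [CompletelyDistribLattice C]

/-- The inequality holds in the canonical extension under the given assignment. -/
def Ineq.Holds (e : A → C) (V : Assignment C) (ρ : ℕ → C) (I : Ineq) : Prop :=
  eval e V I.lhs ρ ≤ eval e V I.rhs ρ

/-- The quasi-inequality holds in the canonical extension under the given assignment. -/
def QuasiIneq.Holds (e : A → C) (V : Assignment C) (ρ : ℕ → C) (Q : QuasiIneq) : Prop :=
  (∀ I ∈ Q.ante, I.Holds e V ρ) → Q.cons.Holds e V ρ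

/-- Both sides are sentences. -/
def Ineq.IsSentence (I : Ineq) : Prop := I.lhs.IsSentence ∧ I.rhs.IsSentence

/-- The starred version of an inequality. -/
def Ineq.star (I : Ineq) : Ineq := ⟨I.lhs.star, I.rhs.star⟩

theorem Ineq.holds_setProp_iff {e : A → C} {V : Assignment C} {ρ : ℕ → C} {I : Ineq} {p : ℕ}
    (h : I.PropFree p) (c : C) : I.Holds e (V.setProp p c) ρ ↔ I.Holds e V ρ := by
  rw [Holds, Holds, eval_setProp_of_notMem h.1, eval_setProp_of_notMem h.2]

theorem Ineq.holds_setNom_iff {e : A → C} {V : Assignment C} {ρ : ℕ → C} {I : Ineq} {j : ℕ}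
    (h : I.NomFree j) {c : C} (hc : IsCJI c) :
    I.Holds e (V.setNom j c hc) ρ ↔ I.Holds e V ρ := by
  rw [Holds, Holds, eval_setNom_of_notMem h.1, eval_setNom_of_notMem h.2]

theorem Ineq.holds_setCnom_iff {e : A → C} {V : Assignment C} {ρ : ℕ → C} {I : Ineq} {m : ℕ}
    (h : I.CnomFree m) {c : C} (hc : IsCMI c) :
    I.Holds e (V.setCnom m c hc) ρ ↔ I.Holds e V ρ := by
  rw [Holds, Holds, eval_setCnom_of_notMem h.1, eval_setCnom_of_notMem h.2]

theorem Ineq.holds_subst_iff {e : A → C} {V : Assignment C} {ρ : ℕ → C} {I : Ineq} {p : ℕ}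
    {α : Form} (hα : α.IsSentence) :
    (I.subst p α).Holds e V ρ ↔ I.Holds e (V.setProp p (eval e V α ρ)) ρ := by
  rw [Holds, Holds, Ineq.subst, eval_subst hα p _ ρ, eval_subst hα p _ ρ]

/-! ### Sentences are preserved -/

theorem LocalRule.isSentence {I : Ineq} {S : Multiset Ineq} (h : LocalRule I S)
    (hI : I.IsSentence) : ∀ J ∈ S, J.IsSentence := by
  cases h <;> simp_all [Ineq.IsSentence, Form.IsSentence, Form.freeVars, Finset.union_eq_empty]

theorem TameStep.isSentence {Q Q' : QuasiIneq} (h : TameStep Q Q')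
    (hQ : ∀ I ∈ Q.ante, I.IsSentence) : ∀ I ∈ Q'.ante, I.IsSentence := by
  cases h with
  | loc Γ c hr =>
    intro J hJ
    rcases Multiset.mem_add.1 hJ with hJ | hJ
    · exact hr.isSentence (hQ _ (Multiset.mem_cons_self _ _)) J hJ
    · exact hQ J (Multiset.mem_cons_of_mem hJ)
  | boxAppr ψ m n Γ c hn =>
    simp_all [Ineq.IsSentence, Form.IsSentence, Form.freeVars]
  | diaAppr ψ j i Γ c hi =>
    simp_all [Ineq.IsSentence, Form.IsSentence, Form.freeVars]
  | impAppr χ φ m j n Γ c hj hn =>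
    simp_all [Ineq.IsSentence, Form.IsSentence, Form.freeVars, Finset.union_eq_empty]
  | subAppr χ φ i j n Γ c hj hn =>
    simp_all [Ineq.IsSentence, Form.IsSentence, Form.freeVars, Finset.union_eq_empty]
  | rightAckermann p αs B R c hα hB hR hc =>
    have hαs : (Form.bigOr αs).IsSentence := Form.isSentence_bigOr fun α hα' =>
      (hQ ⟨α, .prop p⟩ (by simp [hα'])).1
    intro J hJ
    rcases Multiset.mem_add.1 hJ with hJ | hJ
    · obtain ⟨I, hI, rfl⟩ := Multiset.mem_map.1 hJ
      have hI' := hQ I (by simp [hI])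
      exact ⟨hαs.subst hI'.1 p, hαs.subst hI'.2 p⟩
    · exact hQ J (by simp [hJ])
  | leftAckermann p αs B R c hα hB hR hc =>
    have hαs : (Form.bigAnd αs).IsSentence := Form.isSentence_bigAnd fun α hα' =>
      (hQ ⟨.prop p, α⟩ (by simp [hα'])).2
    intro J hJ
    rcases Multiset.mem_add.1 hJ with hJ | hJ
    · obtain ⟨I, hI, rfl⟩ := Multiset.mem_map.1 hJ
      have hI' := hQ I (by simp [hI])
      exact ⟨hαs.subst hI'.1 p, hαs.subst hI'.2 p⟩
    · exact hQ J (by simp [hJ])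

variable {e : BoundedLatticeHom A C} {ρ : ℕ → C}

theorem LocalRule.holds_iff (he : IsCanonicalExtension e) {I : Ineq} {S : Multiset Ineq}
    (h : LocalRule I S) (V : Assignment C) :
    I.Holds e V ρ ↔ ∀ J ∈ S, J.Holds e V ρ := by
  cases h with
  | subLR χ ψ φ => simp [Ineq.Holds, eval, sdiff_le_iff]
  | impRR φ χ ψ => simp [Ineq.Holds, eval, le_himp_iff]
  | andLR χ ψ φ => simp [Ineq.Holds, eval, le_himp_iff]
  | andLR' χ ψ φ => simp [Ineq.Holds, eval, le_himp_iff, inf_comm]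
  | orRR φ χ ψ => simp [Ineq.Holds, eval, sdiff_le_iff]
  | orRR' φ χ ψ => simp [Ineq.Holds, eval, sdiff_le_iff, sup_comm]
  | orLA φ χ ψ => simp [Ineq.Holds, eval]
  | andRA ψ φ χ => simp [Ineq.Holds, eval]
  | diaLA φ ψ => simpa [Ineq.Holds, eval] using he.gc_dia_bbox _ _
  | boxRA φ ψ => simpa [Ineq.Holds, eval] using (he.gc_bdia_box _ _).symm

/-- A step of a tame run preserves validity under admissible assignments. -/
theorem TameStep.holds_of_admissible (he : IsCanonicalExtension e) {Q Q' : QuasiIneq}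
    (h : TameStep Q Q') (hQ : ∀ I ∈ Q.ante, I.IsSentence) (hρ : ∀ X, ∃ a, ρ X = e a)
    (H : ∀ V : Assignment C, V.IsAdmissible e → Q.Holds e V ρ) (V : Assignment C)
    (hV : V.IsAdmissible e) : Q'.Holds e V ρ := by
  cases h with
  | loc Γ c hr =>
    intro hante
    refine H V hV (Multiset.forall_mem_cons.2 ⟨(hr.holds_iff he V).2 fun J hJ => ?_, ?_⟩)
    · exact hante J (Multiset.mem_add.2 (.inl hJ))
    · exact fun J hJ => hante J (Multiset.mem_add.2 (.inr hJ))
  | boxAppr ψ m n Γ c hn =>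
    intro hante
    simp only [Multiset.forall_mem_cons] at hante
    obtain ⟨h₁, h₂, hΓ⟩ := hante
    exact H V hV (Multiset.forall_mem_cons.2 ⟨le_trans (he.boxExt_mono h₂) h₁, hΓ⟩)
  | diaAppr ψ j i Γ c hi =>
    intro hante
    simp only [Multiset.forall_mem_cons] at hante
    obtain ⟨h₁, h₂, hΓ⟩ := hante
    exact H V hV (Multiset.forall_mem_cons.2 ⟨le_trans h₁ (he.diaExt_mono h₂), hΓ⟩)
  | impAppr χ φ m j n Γ c hj hn =>
    intro hante
    simp only [Multiset.forall_mem_cons] at hante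
    obtain ⟨h₁, h₂, h₃, hΓ⟩ := hante
    exact H V hV (Multiset.forall_mem_cons.2 ⟨le_trans (himp_le_himp h₂ h₃) h₁, hΓ⟩)
  | subAppr χ φ i j n Γ c hj hn =>
    intro hante
    simp only [Multiset.forall_mem_cons] at hante
    obtain ⟨h₁, h₂, h₃, hΓ⟩ := hante
    exact H V hV (Multiset.forall_mem_cons.2 ⟨le_trans h₁ (sdiff_le_sdiff h₂ h₃), hΓ⟩)
  | rightAckermann p αs B R c hα hB hR hc =>
    have hαs : (Form.bigOr αs).IsSentence := Form.isSentence_bigOr fun α hα' =>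
      (hQ ⟨α, .prop p⟩ (by simp [hα'])).1
    intro hante
    -- The value of the disjunction is closed, so assigning it to `p` may leave the admissible
    -- assignments. Instead `p` receives some `e a` above it at which the inequalities of `B` still
    -- hold; the `α` remain below `p`.
    have hk : IsClosedElt e (eval e V (Form.bigOr αs) ρ) :=
      he.isClosedElt_eval hV (Form.synOC_bigOr fun α hα' => (hα α hα').2) hρ
    obtain ⟨_, ⟨a, ha, rfl⟩, hW⟩ := (ApproxFamily.of_closed hV p hk).exists_forall_ineq he hB hρ
      fun I hI => (Ineq.holds_subst_iff hαs).1
        (hante _ (Multiset.mem_add.2 (.inl (Multiset.mem_map_of_mem _ hI))))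
    refine (Ineq.holds_setProp_iff hc (e a)).1 (H _ (hV.setProp p a) fun J hJ => ?_)
    simp only [Multiset.mem_add, Multiset.mem_coe, List.mem_map] at hJ
    rcases hJ with (⟨α, hα', rfl⟩ | hJ) | hJ
    · rw [Ineq.Holds, eval_setProp_of_notMem (hα α hα').1]
      simpa [eval, Assignment.setProp] using eval_bigOr_le_iff.1 ha α hα'
    · exact hW J hJ
    · exact (Ineq.holds_setProp_iff (hR J hJ) _).2 (hante J (Multiset.mem_add.2 (.inr hJ)))
  | leftAckermann p αs B R c hα hB hR hc =>
    have hαs : (Form.bigAnd αs).IsSentence := Form.isSentence_bigAnd fun α hα' =>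
      (hQ ⟨.prop p, α⟩ (by simp [hα'])).2
    intro hante
    have hu : IsOpenElt e (eval e V (Form.bigAnd αs) ρ) :=
      he.isOpenElt_eval hV (Form.synOC_bigAnd fun α hα' => (hα α hα').2) hρ
    obtain ⟨_, ⟨a, ha, rfl⟩, hW⟩ := (ApproxFamily.of_isOpen hV p hu).exists_forall_ineq he hB hρ
      fun I hI => (Ineq.holds_subst_iff hαs).1
        (hante _ (Multiset.mem_add.2 (.inl (Multiset.mem_map_of_mem _ hI))))
    refine (Ineq.holds_setProp_iff hc (e a)).1 (H _ (hV.setProp p a) fun J hJ => ?_)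
    simp only [Multiset.mem_add, Multiset.mem_coe, List.mem_map] at hJ
    rcases hJ with (⟨α, hα', rfl⟩ | hJ) | hJ
    · rw [Ineq.Holds, eval_setProp_of_notMem (φ := α) (hα α hα').1]
      simpa [eval, Assignment.setProp] using le_eval_bigAnd_iff.1 ha α hα'
    · exact hW J hJ
    · exact (Ineq.holds_setProp_iff (hR J hJ) _).2 (hante J (Multiset.mem_add.2 (.inr hJ)))

/-- Validity under all assignments is reflected by the steps of a tame run. -/
theorem TameStep.holds_of_holds (he : IsCanonicalExtension e) {Q Q' : QuasiIneq}
    (h : TameStep Q Q') (hQ : ∀ I ∈ Q.ante, I.IsSentence)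
    (H : ∀ V : Assignment C, Q'.Holds e V ρ) (V : Assignment C) : Q.Holds e V ρ := by
  cases h with
  | loc Γ c hr =>
    intro hante
    rw [Multiset.forall_mem_cons, hr.holds_iff he V] at hante
    exact H V fun J hJ => (Multiset.mem_add.1 hJ).elim (hante.1 J) (hante.2 J)
  | boxAppr ψ m n Γ c hn =>
    intro hante
    obtain ⟨hfr, hc⟩ := hn
    simp only [Multiset.forall_mem_cons] at hante hfr
    -- The fresh co-nominal is assigned the witness `n'`; freshness leaves every other inequality
    -- unchanged. The other approximation rules follow the same scheme.
    obtain ⟨n', hn', h₁, h₂⟩ := he.exists_boxExt_le_cmi (V.cnom_cmi m) hante.1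
    refine (Ineq.holds_setCnom_iff hc hn').1 (H (V.setCnom n n' hn') ?_)
    simp only [Multiset.forall_mem_cons]
    refine ⟨?_, ?_, fun I hI => (Ineq.holds_setCnom_iff (hfr.2 I hI) hn').2 (hante.2 I hI)⟩
    · rw [Ineq.Holds, eval_setCnom_of_notMem hfr.1.2]
      simpa [eval, Assignment.setCnom] using h₁
    · rw [Ineq.Holds, eval_setCnom_of_notMem (φ := ψ) hfr.1.1]
      simpa [eval, Assignment.setCnom] using h₂
  | diaAppr ψ j i Γ c hi =>
    intro hante
    obtain ⟨hfr, hc⟩ := hi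
    simp only [Multiset.forall_mem_cons] at hante hfr
    obtain ⟨i', hi', h₁, h₂⟩ := he.exists_le_diaExt_cji (V.nom_cji j) hante.1
    refine (Ineq.holds_setNom_iff hc hi').1 (H (V.setNom i i' hi') ?_)
    simp only [Multiset.forall_mem_cons]
    refine ⟨?_, ?_, fun I hI => (Ineq.holds_setNom_iff (hfr.2 I hI) hi').2 (hante.2 I hI)⟩
    · rw [Ineq.Holds, eval_setNom_of_notMem hfr.1.1]
      simpa [eval, Assignment.setNom] using h₁
    · rw [Ineq.Holds, eval_setNom_of_notMem (φ := ψ) hfr.1.2]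
      simpa [eval, Assignment.setNom] using h₂
  | impAppr χ φ m j n Γ c hj hn =>
    intro hante
    obtain ⟨hfj, hcj⟩ := hj
    obtain ⟨hfn, hcn⟩ := hn
    simp only [Multiset.forall_mem_cons] at hante hfj hfn
    obtain ⟨j', n', hj', hn', h₁, h₂, h₃⟩ := he.exists_himp_cji_cmi (V.cnom_cmi m) hante.1
    refine (Ineq.holds_setNom_iff hcj hj').1 ((Ineq.holds_setCnom_iff hcn hn').1
      (H ((V.setNom j j' hj').setCnom n n' hn') ?_))
    have hfj₁ := hfj.1.1
    have hfn₁ := hfn.1.1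
    simp only [Form.noms, Form.cnoms, Finset.mem_union, not_or] at hfj₁ hfn₁
    simp only [Multiset.forall_mem_cons]
    refine ⟨?_, ?_, ?_, fun I hI => (Ineq.holds_setCnom_iff (hfn.2 I hI) hn').2
      ((Ineq.holds_setNom_iff (hfj.2 I hI) hj').2 (hante.2 I hI))⟩
    · rw [Ineq.Holds, eval_setCnom_of_notMem hfn.1.2]
      simpa [eval, Assignment.setCnom, Assignment.setNom] using h₁
    · rw [Ineq.Holds, eval_setCnom_of_notMem (φ := χ) hfn₁.1,
        eval_setNom_of_notMem (φ := χ) hfj₁.1]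
      simpa [eval, Assignment.setCnom, Assignment.setNom] using h₂
    · rw [Ineq.Holds, eval_setCnom_of_notMem (φ := φ) hfn₁.2,
        eval_setNom_of_notMem (φ := φ) hfj₁.2]
      simpa [eval, Assignment.setCnom, Assignment.setNom] using h₃
  | subAppr χ φ i j n Γ c hj hn =>
    intro hante
    obtain ⟨hfj, hcj⟩ := hj
    obtain ⟨hfn, hcn⟩ := hn
    simp only [Multiset.forall_mem_cons] at hante hfj hfn
    obtain ⟨j', n', hj', hn', h₁, h₂, h₃⟩ := he.exists_sdiff_cji_cmi (V.nom_cji i) hante.1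
    refine (Ineq.holds_setNom_iff hcj hj').1 ((Ineq.holds_setCnom_iff hcn hn').1
      (H ((V.setNom j j' hj').setCnom n n' hn') ?_))
    have hfj₁ := hfj.1.2
    have hfn₁ := hfn.1.2
    simp only [Form.noms, Form.cnoms, Finset.mem_union, not_or] at hfj₁ hfn₁
    simp only [Multiset.forall_mem_cons]
    refine ⟨?_, ?_, ?_, fun I hI => (Ineq.holds_setCnom_iff (hfn.2 I hI) hn').2
      ((Ineq.holds_setNom_iff (hfj.2 I hI) hj').2 (hante.2 I hI))⟩
    · rw [Ineq.Holds, eval_setCnom_of_notMem hfn.1.1, eval_setNom_of_notMem hfj.1.1]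
      simpa [eval, Assignment.setCnom, Assignment.setNom] using h₁
    · rw [Ineq.Holds, eval_setCnom_of_notMem (φ := χ) hfn₁.1,
        eval_setNom_of_notMem (φ := χ) hfj₁.1]
      simpa [eval, Assignment.setCnom, Assignment.setNom] using h₂
    · rw [Ineq.Holds, eval_setCnom_of_notMem (φ := φ) hfn₁.2,
        eval_setNom_of_notMem (φ := φ) hfj₁.2]
      simpa [eval, Assignment.setCnom, Assignment.setNom] using h₃
  | rightAckermann p αs B R c hα hB hR hc =>
    have hαs : (Form.bigOr αs).IsSentence := Form.isSentence_bigOr fun α hα' =>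
      (hQ ⟨α, .prop p⟩ (by simp [hα'])).1
    intro hante
    -- The antecedent puts the disjunction below the value of `p`. Lowering `p` to it shrinks the
    -- positive left sides in `B` and enlarges the negative right sides, so the antecedent of the
    -- new quasi-inequality holds.
    have hle : (V.setProp p (eval e V (Form.bigOr αs) ρ)).LeAt p V := by
      conv => rhs; rw [← V.setProp_self p]
      exact V.leAt_setProp p (eval_bigOr_le_iff.2 fun α hα' =>
        hante ⟨α, .prop p⟩ (by simp [hα']))
    refine H V fun J hJ => ?_
    rcases Multiset.mem_add.1 hJ with hJ | hJ
    · obtain ⟨I, hI, rfl⟩ := Multiset.mem_map.1 hJ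
      exact (Ineq.holds_subst_iff hαs).2 (((he.eval_mono_prop hle _ ρ).1 (hB I hI).1).trans
        (le_trans (hante I (by simp [hI])) ((he.eval_mono_prop hle _ ρ).2 (hB I hI).2.2.1)))
    · exact hante J (by simp [hJ])
  | leftAckermann p αs B R c hα hB hR hc =>
    have hαs : (Form.bigAnd αs).IsSentence := Form.isSentence_bigAnd fun α hα' =>
      (hQ ⟨.prop p, α⟩ (by simp [hα'])).2
    intro hante
    have hle : V.LeAt p (V.setProp p (eval e V (Form.bigAnd αs) ρ)) := by
      conv => lhs; rw [← V.setProp_self p]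
      exact V.leAt_setProp p (le_eval_bigAnd_iff.2 fun α hα' =>
        hante ⟨.prop p, α⟩ (by simp [hα']))
    refine H V fun J hJ => ?_
    rcases Multiset.mem_add.1 hJ with hJ | hJ
    · obtain ⟨I, hI, rfl⟩ := Multiset.mem_map.1 hJ
      exact (Ineq.holds_subst_iff hαs).2 (((he.eval_mono_prop hle _ ρ).2 (hB I hI).1).trans
        (le_trans (hante I (by simp [hI])) ((he.eval_mono_prop hle _ ρ).1 (hB I hI).2.2.1)))
    · exact hante J (by simp [hJ])

/-- A quasi-inequality that some run reduces to a pure one is valid as soon as it is valid under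
admissible assignments. -/
theorem holds_of_reflTransGen_tameStep (he : IsCanonicalExtension e) {Q Q' : QuasiIneq}
    (h : Relation.ReflTransGen TameStep Q Q') (hpure : Q'.IsPure)
    (hQ : ∀ I ∈ Q.ante, I.IsSentence) (hρ : ∀ X, ∃ a, ρ X = e a)
    (H : ∀ V : Assignment C, V.IsAdmissible e → Q.Holds e V ρ) (V : Assignment C) :
    Q.Holds e V ρ := by
  induction h using Relation.ReflTransGen.head_induction_on generalizing V with
  | refl =>
    -- A pure quasi-inequality cannot distinguish `V` from this admissible assignment.
    let W : Assignment C := { V with prop := fun _ => e ⊥ }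
    have key : ∀ I : Ineq, I.IsPure → (I.Holds e W ρ ↔ I.Holds e V ρ) := by
      intro I hI
      have h : ∀ φ : Form, φ.props = ∅ → eval e W φ ρ = eval e V φ ρ := fun φ hφ =>
        eval_congr (by simp [hφ]) (fun _ _ => rfl) (fun _ _ => rfl) (fun _ _ => rfl)
      rw [Ineq.Holds, Ineq.Holds, h _ hI.1, h _ hI.2]
    intro hante
    exact (key _ hpure.2).1 (H W (fun _ => ⟨⊥, rfl⟩) fun I hI =>
      (key I (hpure.1 I hI)).2 (hante I hI))
  | head hstep _ ih =>
    exact hstep.holds_of_holds he hQ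
      (ih (hstep.isSentence hQ) (hstep.holds_of_admissible he hQ hρ H)) V

/-! ### Preprocessing -/

/-- Both sides are sentences without nominals and co-nominals. -/
structure Ineq.IsPlain (I : Ineq) : Prop where
  isSentence : I.IsSentence
  noms : I.lhs.noms = ∅ ∧ I.rhs.noms = ∅
  cnoms : I.lhs.cnoms = ∅ ∧ I.rhs.cnoms = ∅

theorem Distrib.freeVars_eq {s : Bool} {φ φ' : Form} (h : Distrib s φ φ') :
    φ'.freeVars = φ.freeVars := by
  induction h <;> simp only [Form.freeVars] <;> grind

theorem Distrib.noms_eq {s : Bool} {φ φ' : Form} (h : Distrib s φ φ') : φ'.noms = φ.noms := by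
  induction h <;> simp only [Form.noms] <;> grind

theorem Distrib.cnoms_eq {s : Bool} {φ φ' : Form} (h : Distrib s φ φ') : φ'.cnoms = φ.cnoms := by
  induction h <;> simp only [Form.cnoms] <;> grind

theorem Ineq.IsPlain.subst {I : Ineq} (h : I.IsPlain) (p : ℕ) {α : Form} (hα : α.IsSentence)
    (hj : α.noms = ∅) (hm : α.cnoms = ∅) : (I.subst p α).IsPlain := by
  have h₁ := Form.noms_subst_subset p α
  have h₂ := Form.cnoms_subst_subset p α
  simp only [hj, hm, Finset.empty_union] at h₁ h₂
  exact ⟨⟨hα.subst h.1.1 p, hα.subst h.1.2 p⟩,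
    ⟨Finset.subset_empty.1 ((h₁ _).trans h.2.1.subset),
      Finset.subset_empty.1 ((h₁ _).trans h.2.2.subset)⟩,
    ⟨Finset.subset_empty.1 ((h₂ _).trans h.3.1.subset),
      Finset.subset_empty.1 ((h₂ _).trans h.3.2.subset)⟩⟩

theorem PreRule.isPlain {I : Ineq} {L : List Ineq} (h : PreRule I L) (hI : I.IsPlain) :
    ∀ J ∈ L, J.IsPlain := by
  obtain ⟨⟨h₁, h₂⟩, ⟨h₃, h₄⟩, h₅, h₆⟩ := id hI
  cases h with
  | distrib_left hd =>
    simp only [List.mem_singleton, forall_eq]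
    exact ⟨⟨hd.freeVars_eq.trans h₁, h₂⟩, ⟨hd.noms_eq.trans h₃, h₄⟩, ⟨hd.cnoms_eq.trans h₅, h₆⟩⟩
  | distrib_right hd =>
    simp only [List.mem_singleton, forall_eq]
    exact ⟨⟨h₁, hd.freeVars_eq.trans h₂⟩, ⟨h₃, hd.noms_eq.trans h₄⟩, ⟨h₅, hd.cnoms_eq.trans h₆⟩⟩
  | orLA α β γ =>
    simp only [Form.IsSentence, Form.freeVars, Form.noms, Form.cnoms, Finset.union_eq_empty] at *
    simp only [List.mem_cons, List.not_mem_nil, or_false, forall_eq_or_imp, forall_eq]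
    exact ⟨⟨⟨h₁.1, h₂⟩, ⟨h₃.1, h₄⟩, ⟨h₅.1, h₆⟩⟩, ⟨⟨h₁.2, h₂⟩, ⟨h₃.2, h₄⟩, ⟨h₅.2, h₆⟩⟩⟩
  | andRA α β γ =>
    simp only [Form.IsSentence, Form.freeVars, Form.noms, Form.cnoms, Finset.union_eq_empty] at *
    simp only [List.mem_cons, List.not_mem_nil, or_false, forall_eq_or_imp, forall_eq]
    exact ⟨⟨⟨h₁, h₂.1⟩, ⟨h₃, h₄.1⟩, ⟨h₅, h₆.1⟩⟩, ⟨⟨h₁, h₂.2⟩, ⟨h₃, h₄.2⟩, ⟨h₅, h₆.2⟩⟩⟩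
  | botElim p _ _ =>
    simp only [List.mem_singleton, forall_eq]
    exact hI.subst p rfl rfl rfl
  | topElim p _ _ =>
    simp only [List.mem_singleton, forall_eq]
    exact hI.subst p rfl rfl rfl

/-- The diamond is a left adjoint, the box a right adjoint and `C` is distributive, so each
rewriting preserves the value whatever the sign. -/
theorem Distrib.eval_star_eq (he : IsCanonicalExtension e) {s : Bool} {φ φ' : Form}
    (h : Distrib s φ φ') (V : Assignment C) (ρ : ℕ → C) :
    eval e V φ'.star ρ = eval e V φ.star ρ := by
  induction h generalizing ρ with
  | dia_or α β => exact he.gc_dia_bbox.l_sup.symm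
  | and_or_left α β γ => exact (inf_sup_right _ _ _).symm
  | and_or_right α β γ => exact (inf_sup_left _ _ _).symm
  | box_and α β => exact he.gc_bdia_box.u_inf.symm
  | or_and_left α β γ => exact (sup_inf_right _ _ _).symm
  | or_and_right α β γ => exact (sup_inf_left _ _ _).symm
  | _ => simp only [Form.star, eval, *]

theorem Ineq.star_subst (I : Ineq) (p : ℕ) (α : Form) :
    (I.subst p α).star = I.star.subst p α.star := by
  simp [Ineq.star, Ineq.subst, Form.star_subst]

/-- The preprocessing transformations preserve and reflect validity, over all assignments as well as
over the admissible ones. -/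
theorem PreRule.holds_iff (he : IsCanonicalExtension e) {I : Ineq} {L : List Ineq}
    (h : PreRule I L) {P : Assignment C → Prop}
    (hP : ∀ V p a, P V → P (V.setProp p (e a))) :
    (∀ V, P V → I.star.Holds e V ρ) ↔ ∀ J ∈ L, ∀ V, P V → J.star.Holds e V ρ := by
  cases h with
  | distrib_left hd =>
    simp only [List.mem_singleton, forall_eq, Ineq.Holds, Ineq.star, hd.eval_star_eq he]
  | distrib_right hd =>
    simp only [List.mem_singleton, forall_eq, Ineq.Holds, Ineq.star, hd.eval_star_eq he]
  | orLA α β γ =>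
    simp only [List.mem_cons, List.not_mem_nil, or_false, forall_eq_or_imp, forall_eq, Ineq.Holds,
      Ineq.star, Form.star, eval, sup_le_iff]
    exact ⟨fun h => ⟨fun V hV => (h V hV).1, fun V hV => (h V hV).2⟩,
      fun h V hV => ⟨h.1 V hV, h.2 V hV⟩⟩
  | andRA α β γ =>
    simp only [List.mem_cons, List.not_mem_nil, or_false, forall_eq_or_imp, forall_eq, Ineq.Holds,
      Ineq.star, Form.star, eval, le_inf_iff]
    exact ⟨fun h => ⟨fun V hV => (h V hV).1, fun V hV => (h V hV).2⟩,
      fun h V hV => ⟨h.1 V hV, h.2 V hV⟩⟩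
  | @botElim α β p hα hβ =>
    simp only [List.mem_singleton, forall_eq]
    have key : ∀ V, (Ineq.star ⟨Form.subst p .bot α, Form.subst p .bot β⟩).Holds e V ρ ↔
        (Ineq.star ⟨α, β⟩).Holds e (V.setProp p (e ⊥)) ρ := fun V => by
      rw [map_bot]
      exact Ineq.star_subst ⟨α, β⟩ p .bot ▸ Ineq.holds_subst_iff (α := .bot) rfl
    refine ⟨fun h V hV => (key V).2 (h _ (hP V p ⊥ hV)), fun h V hV => ?_⟩
    -- Raising `p` from `⊥` to its actual value can only lower `α` and raise `β`, so `⊥` is the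
    -- worst case.
    have hle : (V.setProp p (e ⊥)).LeAt p V := by
      conv => rhs; rw [← V.setProp_self p]
      exact V.leAt_setProp p (by simp)
    exact ((he.eval_mono_prop hle _ ρ).2 ((Form.propSign_star _ _ _).2 hα)).trans
      (le_trans ((key V).1 (h V hV))
        ((he.eval_mono_prop hle _ ρ).1 ((Form.propSign_star _ _ _).2 hβ)))
  | @topElim α β p hα hβ =>
    simp only [List.mem_singleton, forall_eq]
    have key : ∀ V, (Ineq.star ⟨Form.subst p .top α, Form.subst p .top β⟩).Holds e V ρ ↔
        (Ineq.star ⟨α, β⟩).Holds e (V.setProp p (e ⊤)) ρ := fun V => by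
      rw [map_top]
      exact Ineq.star_subst ⟨α, β⟩ p .top ▸ Ineq.holds_subst_iff (α := .top) rfl
    refine ⟨fun h V hV => (key V).2 (h _ (hP V p ⊤ hV)), fun h V hV => ?_⟩
    have hle : V.LeAt p (V.setProp p (e ⊤)) := by
      conv => lhs; rw [← V.setProp_self p]
      exact V.leAt_setProp p (by simp)
    exact ((he.eval_mono_prop hle _ ρ).1 ((Form.propSign_star _ _ _).2 hα)).trans
      (le_trans ((key V).1 (h V hV))
        ((he.eval_mono_prop hle _ ρ).2 ((Form.propSign_star _ _ _).2 hβ)))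

theorem PreStep.isPlain {L L' : List Ineq} (h : PreStep L L') (hL : ∀ I ∈ L, I.IsPlain) :
    ∀ I ∈ L', I.IsPlain := by
  obtain ⟨L₁, L₂, hr⟩ := h
  simp only [List.forall_mem_append, List.forall_mem_cons] at hL ⊢
  exact ⟨⟨hL.1, hr.isPlain hL.2.1⟩, hL.2.2⟩

theorem PreStep.holds_iff (he : IsCanonicalExtension e) {L L' : List Ineq} (h : PreStep L L')
    {P : Assignment C → Prop} (hP : ∀ V p a, P V → P (V.setProp p (e a))) :
    (∀ I ∈ L, ∀ V, P V → I.star.Holds e V ρ) ↔ ∀ I ∈ L', ∀ V, P V → I.star.Holds e V ρ := by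
  obtain ⟨L₁, L₂, hr⟩ := h
  simp only [List.forall_mem_append, List.forall_mem_cons]
  rw [hr.holds_iff he hP, and_assoc]

theorem isPlain_of_reflTransGen_preStep {L L' : List Ineq}
    (h : Relation.ReflTransGen PreStep L L') (hL : ∀ I ∈ L, I.IsPlain) : ∀ I ∈ L', I.IsPlain := by
  induction h with
  | refl => exact hL
  | tail _ hstep ih => exact hstep.isPlain ih

theorem holds_iff_of_reflTransGen_preStep (he : IsCanonicalExtension e) {L L' : List Ineq}
    (h : Relation.ReflTransGen PreStep L L') {P : Assignment C → Prop}
    (hP : ∀ V p a, P V → P (V.setProp p (e a))) :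
    (∀ I ∈ L, ∀ V, P V → I.star.Holds e V ρ) ↔ ∀ I ∈ L', ∀ V, P V → I.star.Holds e V ρ := by
  induction h with
  | refl => rfl
  | tail _ hstep ih => exact ih.trans (hstep.holds_iff he hP)

/-! ### First approximation -/

theorem firstApprox_holds {I : Ineq} {V : Assignment C} (h : I.star.Holds e V ρ) (j m : ℕ) :
    (firstApprox j m I).Holds e V ρ := fun hante =>
  le_trans (hante ⟨.nom j, I.lhs.star⟩ (by simp [firstApprox]))
    (le_trans h (hante ⟨I.rhs.star, .cnom m⟩ (by simp [firstApprox])))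

/-- A failure of the inequality is separated by an irreducible pair, which is assigned to `j` and
`m`. Plain formulas contain neither symbol, so their values do not change. -/
theorem IsCanonicalExtension.holds_of_firstApprox (he : IsCanonicalExtension e) {I : Ineq}
    (hI : I.IsPlain) {j m : ℕ} (H : ∀ V : Assignment C, (firstApprox j m I).Holds e V ρ)
    (V : Assignment C) : I.star.Holds e V ρ := by
  by_contra hn
  obtain ⟨j', m', hj', hm', hj, hm, hjm⟩ := he.exists_cji_cmi hn
  have key : ∀ φ : Form, φ.noms = ∅ → φ.cnoms = ∅ →
      eval e ((V.setNom j j' hj').setCnom m m' hm') φ.star ρ = eval e V φ.star ρ := by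
    intro φ h₁ h₂
    rw [eval_setCnom_of_notMem (by simp [h₂]), eval_setNom_of_notMem (by simp [h₁])]
  refine hjm ?_
  have := H ((V.setNom j j' hj').setCnom m m' hm') (by
    simp only [firstApprox, Multiset.insert_eq_cons, Multiset.forall_mem_cons,
      Multiset.mem_singleton, forall_eq, Ineq.Holds, key _ hI.2.1 hI.3.1, key _ hI.2.2 hI.3.2]
    exact ⟨by simpa [eval, Assignment.setNom, Assignment.setCnom, Ineq.star] using hj,
      by simpa [eval, Assignment.setNom, Assignment.setCnom, Ineq.star] using hm⟩)
  simpa [firstApprox, Ineq.Holds, eval, Assignment.setNom, Assignment.setCnom] using this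

theorem firstApprox_isSentence {I : Ineq} (hI : I.IsSentence) (j m : ℕ) :
    ∀ J ∈ (firstApprox j m I).ante, J.IsSentence := by
  simp only [firstApprox, Multiset.insert_eq_cons, Multiset.forall_mem_cons,
    Multiset.mem_singleton, forall_eq, Ineq.IsSentence, Form.IsSentence, Form.freeVars_star]
  exact ⟨⟨rfl, hI.1⟩, hI.2, rfl⟩

/-- If a tame run succeeds, validity under admissible assignments implies validity. -/
theorem TameRunSucceeds.holds (he : IsCanonicalExtension e) {φ ψ : Form}
    (hrun : TameRunSucceeds φ ψ) (hI : Ineq.IsPlain ⟨φ, ψ⟩) (hρ : ∀ X, ∃ a, ρ X = e a)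
    (H : ∀ V : Assignment C, V.IsAdmissible e → (Ineq.star ⟨φ, ψ⟩).Holds e V ρ)
    (V : Assignment C) : (Ineq.star ⟨φ, ψ⟩).Holds e V ρ := by
  obtain ⟨L, hL, hrun⟩ := hrun
  have hplain := isPlain_of_reflTransGen_preStep hL (by simpa using hI)
  -- The preprocessing equivalence is used twice: forwards for admissible assignments, and backwards
  -- for all assignments once the runs have removed the restriction.
  have hadm := (holds_iff_of_reflTransGen_preStep he hL (P := Assignment.IsAdmissible e) (ρ := ρ)
    fun V p a hV => hV.setProp p a).1 (by simpa using H)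
  have hall := (holds_iff_of_reflTransGen_preStep he hL (P := fun _ : Assignment C => True)
    (ρ := ρ) fun _ _ _ _ => trivial).2 fun I hIL V _ => by
      obtain ⟨j, m, Q, hQ, hpure⟩ := hrun I hIL
      exact he.holds_of_firstApprox (hplain I hIL) (holds_of_reflTransGen_tameStep he hQ hpure
        (firstApprox_isSentence (hplain I hIL).1 j m) hρ
        fun V hV => firstApprox_holds (hadm I hIL V hV) j m) V
  exact hall _ (by simp) V trivial

end Runs

end MuALBA

theorem mainTheorem2 (φ ψ : MuALBA.Form) (hφ : φ.IsL1) (hψ : ψ.IsL1)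
    (hφs : φ.IsSentence) (hψs : ψ.IsSentence) (hrun : MuALBA.TameRunSucceeds φ ψ) :
    MuALBA.IsTameCanonical.{u, v} φ ψ := by
  intro A _ hA C _ e he
  constructor
  · intro hvalid V ρ
    -- The approximation argument needs environments with values in `A`; for sentences any
    -- environment may be exchanged for a constant one.
    rw [MuALBA.eval_eq_of_isSentence (by simpa [MuALBA.Form.IsSentence] using hφs) ρ fun _ => e ⊥,
      MuALBA.eval_eq_of_isSentence (by simpa [MuALBA.Form.IsSentence] using hψs) ρ fun _ => e ⊥]
    refine hrun.holds he ⟨⟨hφs, hψs⟩, ⟨hφ.noms_eq, hψ.noms_eq⟩, ⟨hφ.cnoms_eq, hψ.cnoms_eq⟩⟩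
      (fun _ => ⟨⊥, rfl⟩) (fun W hW => ?_) V
    choose v hv using hW
    obtain ⟨a, ha⟩ := hA φ hφ v fun _ => ⊥
    obtain ⟨b, hb⟩ := hA ψ hψ v fun _ => ⊥
    change MuALBA.eval e W φ.star _ ≤ MuALBA.eval e W ψ.star _
    rw [he.eval_star_of_denotes hA hv hφ ha, he.eval_star_of_denotes hA hv hψ hb]
    exact he.map_le_map_iff.2 (hvalid v _ a b ha hb)
  · intro hvalid v ρ a b ha hb
    by_contra hab
    -- An assignment must interpret nominals and co-nominals, and irreducible elements need not
    -- exist in a trivial lattice. The assumed failure of the inequality provides them.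
    obtain ⟨j, m, hj, hm, -⟩ := he.exists_cji_cmi fun h => hab (he.map_le_map_iff.1 h)
    let V : MuALBA.Assignment C :=
      ⟨fun p => e (v p), fun _ => j, fun _ => m, fun _ => hj, fun _ => hm⟩
    have h := hvalid V fun X => e (ρ X)
    rw [he.eval_star_of_denotes hA (fun _ => rfl) hφ ha,
      he.eval_star_of_denotes hA (fun _ => rfl) hψ hb] at h
    exact hab (he.map_le_map_iff.1 h)
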